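/- Let $G$ be a finitely generated virtually abelian group. Then every finite generating set of $G$ is contained in a finite generating set $Z$ of $G$ with $Z = Z^{-1}$ such that $(G,Z)$ has NSC and FFTP and such that $(G,Z)$ admits a geodesic prefix-closed biautomatic structure. Here words over $Z$ are finite sequences $W$ of elements of $Z$; $\ell(W)$ is the length of $W$, we write $W$ also for the element of $G$ that the word represents, $|g|_Z$ is the least length of a word over $Z$ representing $g \in G$, and $\mathrm{d}(g,h) = |g^{-1}h|_Z$ is the distance in the Cayley graph $\Gamma(G,Z)$. A path $p$ in $\Gamma(G,Z)$ of length $n$ has vertices $p(0),\dots,p(n)$, and $p(t)=p(n)$ for $t\ge n$; a path is geodesic if no path with the same endpoints is shorter, a word is geodesic if it labels a geodesic path, and it is a cyclic geodesic if all its cyclic permutations are geodesic. Two paths $p,q$ *synchronously $K$-fellow travel* if $\mathrm{d}(p(t),q(t))\le K$ for all $t\in\mathbb{N}$, and *asynchronously $K$-fellow travel* if there are non-decreasing functions $\phi,\psi\colon\mathbb{N}\to\mathbb{N}$ with $\mathrm{d}(p(t),q(\phi(t)))\le K$ and $\mathrm{d}(p(\psi(t)),q(t))\le K$ for all $t\in\mathbb{N}$.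 - **FFTP** (falsification by fellow traveler property): there is $K\ge 0$ such that for every non-geodesic path $p$ in $\Gamma(G,Z)$ there is a shorter path $q$ with the same endpoints such that $p$ and $q$ asynchronously $K$-fellow travel. - **NSC** (neighboring shorter conjugate property): there is $B\ge 0$ such that for every cyclic geodesic $U$ with $\ell(U)\ge B$ that is conjugate in $G$ to some $h$ with $|h|_Z<\ell(U)$ there are a cyclic permutation $U'$ of $U$ and $g\in G$ with $|g|_Z\le B$ and $|gU'g^{-1}|_Z<\ell(U)$. - A **geodesic prefix-closed biautomatic structure** for $(G,Z)$ is a regular language $\mathcal{L}$ over $Z$ that maps onto $G$, consists of geodesic words, contains all prefixes of its words, and for which there is $M\ge 0$ such that, for all $W,U\in\mathcal{L}$ and $x,y\in Z\cup\{1\}$ with $U=xWy$ in $G$, the path labelled $W$ starting at $x$ and the path labelled $U$ starting at $1$ synchronously $M$-fellow travel. -/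

import Mathlib

namespace CayleyGeom

/-- A group is virtually abelian if it has an abelian subgroup of finite index. -/
def IsVirtuallyAbelian (G : Type*) [Group G] : Prop :=
  ∃ N : Subgroup G, N.FiniteIndex ∧ ∀ a ∈ N, ∀ b ∈ N, a * b = b * a

/-- `X` is a finite symmetric generating set of `G`. (By symmetry `X` then also generates `G` as a
monoid, so that every element of `G` is the value of a word over `X`.) -/
structure IsFiniteSymmGenSet {G : Type*} [Group G] (X : Set G) : Prop where
  finite : X.Finite
  inv_mem : ∀ x ∈ X, x⁻¹ ∈ X
  closure_eq_top : Subgroup.closure X = ⊤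

/-- The element of `G` represented by a word over `X`. -/
def value {G : Type*} [Group G] {X : Set G} (W : List X) : G :=
  (W.map (fun x : X => (x : G))).prod

/-- `|g|_X`: the minimal length of a word over `X` that represents `g`. -/
noncomputable def wordLength {G : Type*} [Group G] (X : Set G) (g : G) : ℕ :=
  sInf {n : ℕ | ∃ W : List X, value W = g ∧ W.length = n}

/-- The distance between two vertices of the Cayley graph of `G` with respect to `X`, in which
`g` is joined to `g * x` for all `x ∈ X`. -/
noncomputable def dist {G : Type*} [Group G] (X : Set G) (g h : G) : ℕ :=
  wordLength X (g⁻¹ * h)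

/-- A path in the Cayley graph of `G` with respect to `X`; it is determined by its first vertex
and its label, a word over `X`. -/
structure Path {G : Type*} [Group G] (X : Set G) where
  start : G
  label : List X

/-- The length of a path. -/
def Path.length {G : Type*} [Group G] {X : Set G} (p : Path X) : ℕ :=
  p.label.length

/-- The `t`-th vertex of a path; for `t` at least the length it is the last vertex. -/
def Path.vertex {G : Type*} [Group G] {X : Set G} (p : Path X) (t : ℕ) : G :=
  p.start * value (p.label.take t)

/-- The last vertex of a path. -/
def Path.terminus {G : Type*} [Group G] {X : Set G} (p : Path X) : G :=
  p.start * value p.label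

/-- A path is geodesic if it is no longer than any path with the same endpoints. -/
def Path.IsGeodesic {G : Type*} [Group G] {X : Set G} (p : Path X) : Prop :=
  ∀ q : Path X, q.start = p.start → q.terminus = p.terminus → p.length ≤ q.length

/-- A word is geodesic if the path from `1` with this label is geodesic. -/
def IsGeodesicWord {G : Type*} [Group G] {X : Set G} (W : List X) : Prop :=
  (Path.mk (1 : G) W).IsGeodesic

/-- A word is a cyclic geodesic if all its cyclic shifts are geodesic. -/
def IsCyclicGeodesic {G : Type*} [Group G] {X : Set G} (W : List X) : Prop :=
  ∀ W' : List X, W.IsRotated W' → IsGeodesicWord W'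

/-- Synchronous `K`-fellow traveling of paths. -/
def SyncFellowTravel {G : Type*} [Group G] {X : Set G} (K : ℕ) (p q : Path X) : Prop :=
  ∀ t : ℕ, dist X (p.vertex t) (q.vertex t) ≤ K

/-- Asynchronous `K`-fellow traveling of paths. -/
def AsyncFellowTravel {G : Type*} [Group G] {X : Set G} (K : ℕ) (p q : Path X) : Prop :=
  ∃ φ ψ : ℕ → ℕ, Monotone φ ∧ Monotone ψ ∧
    (∀ t : ℕ, dist X (p.vertex t) (q.vertex (φ t)) ≤ K) ∧
    (∀ t : ℕ, dist X (p.vertex (ψ t)) (q.vertex t) ≤ K)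

/-- `(G, X)` has the falsification by fellow traveler property. -/
def FFTP {G : Type*} [Group G] (X : Set G) : Prop :=
  ∃ K : ℕ, ∀ p : Path X, ¬ p.IsGeodesic →
    ∃ q : Path X, q.length < p.length ∧ q.start = p.start ∧ q.terminus = p.terminus ∧
      AsyncFellowTravel K p q

/-- `(G, X)` has the neighboring shorter conjugate property. -/
def NSC {G : Type*} [Group G] (X : Set G) : Prop :=
  ∃ B : ℕ, ∀ U : List X, IsCyclicGeodesic U → B ≤ U.length →
    (∃ h : G, IsConj (value U) h ∧ wordLength X h < U.length) →
      ∃ U' : List X, U.IsRotated U' ∧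
        ∃ g : G, wordLength X g ≤ B ∧ wordLength X (g * value U' * g⁻¹) < U.length

/-- The language `L` over the alphabet `X` is a biautomatic structure for `(G, X)`. If `U` and `W`
are in `L` and `U` represents `x * W * y`, then the path from `x` labelled `W` and the path from
`1` labelled `U` start at distance at most one and end at distance at most one; all such
pairs of paths have to fellow travel uniformly. -/
structure IsBiautomaticStructure {G : Type*} [Group G] {X : Set G} (L : Language X) : Prop where
  regular : L.IsRegular
  surjective : ∀ g : G, ∃ W ∈ L, value W = g
  fellowTravel : ∃ M : ℕ, ∀ W ∈ L, ∀ U ∈ L, ∀ x ∈ X ∪ {1}, ∀ y ∈ X ∪ {1},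
    value U = x * value W * y → SyncFellowTravel M (Path.mk x W) (Path.mk 1 U)

/-- A language is prefix-closed if it contains every prefix of each of its words. -/
def IsPrefixClosed {A : Type*} (L : Language A) : Prop :=
  ∀ W ∈ L, ∀ V : List A, V <+: W → V ∈ L

/-- `L` is a geodesic prefix-closed biautomatic structure for `(G, X)`. -/
structure IsGeodesicPrefixClosedBiautomatic {G : Type*} [Group G] {X : Set G}
    (L : Language X) : Prop where
  biautomatic : IsBiautomaticStructure L
  geodesic : ∀ W ∈ L, IsGeodesicWord W
  prefixClosed : IsPrefixClosed L

end CayleyGeom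

namespace CayleyGeom

/-! ### Dickson's lemma -/

/-! Let `N` be an abelian normal subgroup of finite index `m`. Enlarge the given generating set to a
`Z` whose letters in `N` are permuted by conjugation and for which a word of `m` letters outside `N`
is never geodesic (`exists_isAdaptedGenSet`). Pushing the outer letters of a word to the right
conjugates the inner letters and so preserves length. A word thus amounts to a multiset `a` of inner
letters and an outer word `τ`, and for geodesics only finitely many `τ` occur. Statements about
geodesics become statements about multisets over a finite alphabet, where Dickson's lemma supplies
uniform bounds.

FFTP: for fixed `τ`, the multisets `a` for which `a τ` can be shortened form an upward closed set,
so a bounded part of `a` already witnesses the shortening. The remaining inner letters are spelled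
by a path close to the original one (`exists_shadow`). NSC: apply Dickson's lemma to pairs
consisting of the inner parts of the cyclic geodesic and of the conjugator. In a minimal pair the
conjugator is bounded, and restoring the letters of the cyclic geodesic keeps the conjugate shorter.

Biautomaticity needs normal forms. Faces (`IsFace`) are a combinatorial stand-in for faces of the
convex hull of the inner letters, and a flag is a decreasing list of faces. Every tight multiset has
the value and size of a flag plus a bounded remainder (`exists_flag_of_isTight`), and a flag is
determined by its value (`IsFlag.eq_of_map_eq`). By Dickson's lemma, flags whose values differ by a
fixed element have nearly equal multiplicities, and since they are sorted, their prefixes stay close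
(`exists_flagPrefixesWithin`). The structure consists of the geodesic words that spell a flag
followed by boundedly many letters. Conjugation permutes faces, which handles multiplication on the
left. -/

theorem exists_small_le_of_wellQuasiOrdered {β : Type*} [PartialOrder β] [WellQuasiOrderedLE β]
    (U : Set β) (size : β → ℕ) : ∃ C : ℕ, ∀ u ∈ U, ∃ m ∈ U, m ≤ u ∧ size m ≤ C := by
  -- Minimal elements form an antichain, and antichains in a well-quasi-order are finite.
  have hfin : {m | Minimal (· ∈ U) m}.Finite :=
    WellQuasiOrderedLE.finite_of_isAntichain (setOfPred_minimal_antichain _)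
  obtain ⟨C, hC⟩ := (hfin.image size).bddAbove
  refine ⟨C, fun u hu => ?_⟩
  obtain ⟨m, hmu, hm⟩ := exists_minimal_le_of_wellFoundedLT (· ∈ U) u hu
  exact ⟨m, hm.prop, hmu, hC ⟨m, hm, rfl⟩⟩

instance wellQuasiOrderedLE_multiset {α : Type*} [Finite α] :
    WellQuasiOrderedLE (Multiset α) where
  wqo f := by
    classical
    obtain ⟨i, j, hij, h⟩ :=
      (wellQuasiOrdered_le : WellQuasiOrdered (α := α → ℕ) (· ≤ ·)) (fun n s => (f n).count s)
    exact ⟨i, j, hij, Multiset.le_iff_count.2 h⟩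

/-- Every multiset splits off a bounded part such that no multiset carried by the remaining
letters meets `U`, unless the multiset itself lies above an element of `U`. -/
theorem exists_bounded_part {α : Type*} [Finite α] [DecidableEq α] (U : Set (Multiset α)) :
    ∃ C : ℕ, ∀ a : Multiset α, (∀ u ∈ U, ¬ u ≤ a) →
      ∃ r a' : Multiset α, a = r + a' ∧ r.card ≤ C ∧
        ∀ d : Multiset α, (∀ s ∈ d, s ∈ a') → d ∉ U := by
  obtain ⟨C, hC⟩ := exists_small_le_of_wellQuasiOrdered U Multiset.card
  have := Fintype.ofFinite α
  refine ⟨Fintype.card α * C, fun a ha => ?_⟩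
  -- Truncate all multiplicities at `C`. A letter that survives in `a - r` has multiplicity above
  -- `C` in `a`, so every multiset of size at most `C` in such letters lies below `a`.
  let r : Multiset α := ∑ s : α, Multiset.replicate (min (a.count s) C) s
  have hr : ∀ s, r.count s = min (a.count s) C := fun s => by
    simp [r, Multiset.count_sum', Multiset.count_replicate]
  have hra : r ≤ a := Multiset.le_iff_count.2 fun s => by rw [hr]; exact min_le_left _ _
  refine ⟨r, a - r, (add_tsub_cancel_of_le hra).symm, ?_, fun d hd hdU => ?_⟩
  · simp only [r, Multiset.card_sum, Multiset.card_replicate]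
    refine (Finset.sum_le_card_nsmul _ _ C fun s _ => min_le_right _ _).trans ?_
    simp
  · obtain ⟨m, hmU, hmd, hmC⟩ := hC d hdU
    refine ha m hmU (Multiset.le_iff_count.2 fun s => ?_)
    by_cases hs : s ∈ m
    · have h1 := Multiset.count_pos.2 (hd s (Multiset.mem_of_le hmd hs))
      rw [Multiset.count_sub, hr] at h1
      have h2 := Multiset.count_le_card s m
      omega
    · simp [Multiset.count_eq_zero_of_notMem hs]

/-! ### Faces -/

variable {α M : Type*} [AddCancelCommMonoid M] (π : Multiset α →+ M)

/-- A multiset of letters is tight if it is a shortest representative of its value. -/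
def IsTight (a : Multiset α) : Prop := ∀ b, π b = π a → a.card ≤ b.card

/-- A face is a nonempty set of letters that carries only tight multisets, and carries with a
multiset all multisets of the same value and size. -/
structure IsFace (F : Finset α) : Prop where
  nonempty : F.Nonempty
  tight : ∀ a : Multiset α, (∀ s ∈ a, s ∈ F) → IsTight π a
  closed : ∀ a b : Multiset α, (∀ s ∈ a, s ∈ F) → π a = π b → a.card = b.card → ∀ s ∈ b, s ∈ F

variable {π}

theorem IsTight.mono {a b : Multiset α} (h : IsTight π b) (hab : a ≤ b) : IsTight π a := by
  intro c hc
  obtain ⟨e, rfl⟩ := Multiset.le_iff_exists_add.1 hab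
  have := h (c + e) (by simp [hc])
  simpa using this

/-- `F` collects all letters that occur in some multiset with the value and size of a multiset over
`A`. Summing one witness per letter gives a single pair `a'`, `b'` with `b'` containing all of `F`.
A multiset `d` over `F` then lies below `d.card • b'`, which has the value and size of a multiset
over `A`; adding the complement transfers tightness and closedness. -/
theorem exists_face [Finite α] {A : Finset α} (hA : A.Nonempty)
    (h : ∀ a : Multiset α, (∀ s ∈ a, s ∈ A) → IsTight π a) :
    ∃ F, IsFace π F ∧ A ⊆ F ∧ ∃ a b : Multiset α, (∀ s ∈ a, s ∈ A) ∧ π a = π b ∧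
      a.card = b.card ∧ F.val ≤ b := by
  classical
  have := Fintype.ofFinite α
  let P : α → Multiset α → Multiset α → Prop := fun s a b =>
    (∀ s ∈ a, s ∈ A) ∧ π a = π b ∧ a.card = b.card ∧ s ∈ b
  let F : Finset α := Finset.univ.filter fun s => ∃ a b, P s a b
  have hF : ∀ s, s ∈ F ↔ ∃ a b, P s a b := fun s => by simp [F]
  choose! a b hab using fun s => (hF s).1
  set a' := ∑ s ∈ F, a s with ha'
  set b' := ∑ s ∈ F, b s with hb'
  have haA : ∀ s ∈ a', s ∈ A := fun s hs => by
    obtain ⟨t, ht, hst⟩ := Multiset.mem_sum.1 hs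
    exact (hab t ht).1 s hst
  have hπ : π a' = π b' := by
    rw [ha', hb', map_sum, map_sum]
    exact Finset.sum_congr rfl fun s hs => (hab s hs).2.1
  have hcard : a'.card = b'.card := by
    rw [ha', hb', Multiset.card_sum, Multiset.card_sum]
    exact Finset.sum_congr rfl fun s hs => (hab s hs).2.2.1
  have hFb : ∀ s ∈ F, s ∈ b' := fun s hs => Multiset.mem_sum.2 ⟨s, hs, (hab s hs).2.2.2⟩
  have hle : ∀ d : Multiset α, (∀ s ∈ d, s ∈ F) → d ≤ d.card • b' := fun d hd => by
    refine Multiset.le_iff_count.2 fun s => ?_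
    by_cases hs : s ∈ d
    · rw [Multiset.count_nsmul]
      have h1 := Multiset.count_pos.2 (hFb s (hd s hs))
      exact (Multiset.count_le_card s d).trans (Nat.le_mul_of_pos_right _ h1)
    · simp [Multiset.count_eq_zero_of_notMem hs]
  have hAn : ∀ n : ℕ, ∀ s ∈ n • a', s ∈ A := fun n s hs => haA s (Multiset.mem_of_mem_nsmul hs)
  have hAF : A ⊆ F := fun s hs => (hF s).2 ⟨{s}, {s}, by simpa using hs, rfl, rfl, by simp⟩
  refine ⟨F, ⟨hA.mono hAF, fun d hd c hc => ?_, fun d c hd hdc hcd => ?_⟩, hAF, a', b', haA, hπ,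
    hcard, ?_⟩
  · obtain ⟨e, he⟩ := Multiset.le_iff_exists_add.1 (hle d hd)
    have h1 := h _ (hAn d.card) (c + e) (by
      rw [map_add, hc, ← map_add, ← he, map_nsmul, map_nsmul, hπ])
    rw [Multiset.card_nsmul, hcard, ← Multiset.card_nsmul, he] at h1
    simpa using h1
  · obtain ⟨e, he⟩ := Multiset.le_iff_exists_add.1 (hle d hd)
    intro s hs
    refine (hF s).2 ⟨d.card • a', c + e, hAn _, ?_, ?_, by simp [hs]⟩
    · rw [map_add, ← hdc, ← map_add, ← he, map_nsmul, map_nsmul, hπ]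
    · rw [Multiset.card_add, ← hcd, ← Multiset.card_add, ← he, Multiset.card_nsmul,
        Multiset.card_nsmul, hcard]
  · exact (Multiset.le_iff_subset F.nodup).2 fun s hs => hFb s hs

/-- A list of faces that decreases weakly. -/
structure IsFlag (π : Multiset α →+ M) (f : List (Finset α)) : Prop where
  face : ∀ F ∈ f, IsFace π F
  pairwise : f.Pairwise (fun F H => H ⊆ F)

/-- The sum of a multiset of finite sets of letters. -/
def faceSum (f : Multiset (Finset α)) : Multiset α := (f.map Finset.val).sum

@[simp] theorem faceSum_zero : faceSum (0 : Multiset (Finset α)) = 0 := rfl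

@[simp] theorem faceSum_cons (F : Finset α) (f : Multiset (Finset α)) :
    faceSum (F ::ₘ f) = F.val + faceSum f := by simp [faceSum]

@[simp] theorem faceSum_add (f f' : Multiset (Finset α)) :
    faceSum (f + f') = faceSum f + faceSum f' := by simp [faceSum]

theorem mem_faceSum {s : α} {f : Multiset (Finset α)} : s ∈ faceSum f ↔ ∃ F ∈ f, s ∈ F := by
  induction f using Multiset.induction_on <;> simp_all

theorem IsFlag.nil : IsFlag π [] := ⟨by simp, by simp⟩

theorem IsFlag.sublist {f f' : List (Finset α)} (h : IsFlag π f) (hf : f'.Sublist f) :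
    IsFlag π f' :=
  ⟨fun F hF => h.face F (hf.subset hF), h.pairwise.sublist hf⟩

theorem IsFlag.mem_faceSum_cons {F : Finset α} {f : List (Finset α)} (h : IsFlag π (F :: f))
    {s : α} : s ∈ faceSum (F :: f : List (Finset α)) ↔ s ∈ F := by
  rw [mem_faceSum]
  refine ⟨?_, fun hs => ⟨F, by simp, hs⟩⟩
  rintro ⟨H, hH, hs⟩
  rcases List.mem_cons.1 (Multiset.mem_coe.1 hH) with rfl | hH
  · exact hs
  · exact (List.pairwise_cons.1 h.pairwise).1 H hH hs

theorem IsFlag.tight {f : List (Finset α)} (h : IsFlag π f) : IsTight π (faceSum f) := by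
  cases f with
  | nil => intro b _; simp
  | cons F f => exact (h.face F (by simp)).tight _ fun s hs => h.mem_faceSum_cons.1 hs

/-- Tightness forces equal sizes. The first face of a flag is the set of letters of its sum, so
closedness identifies the first faces of the two flags; cancel them and recurse. -/
theorem IsFlag.eq_of_map_eq {f f' : List (Finset α)} (h : IsFlag π f) (h' : IsFlag π f')
    (hπ : π (faceSum f) = π (faceSum f')) : f = f' := by
  have hcard : (faceSum (f : Multiset (Finset α))).card = (faceSum (f' : Multiset _)).card :=
    le_antisymm (h.tight _ hπ.symm) (h'.tight _ hπ)
  induction f generalizing f' with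
  | nil =>
    cases f' with
    | nil => rfl
    | cons F f' =>
      have := (h'.face F (by simp)).nonempty.card_pos
      simp only [← Multiset.cons_coe, faceSum_cons, Multiset.coe_nil, faceSum_zero,
        Multiset.card_zero, Multiset.card_add, Finset.card_val] at hcard
      omega
  | cons F f ih =>
    cases f' with
    | nil =>
      have := (h.face F (by simp)).nonempty.card_pos
      simp only [← Multiset.cons_coe, faceSum_cons, Multiset.coe_nil, faceSum_zero,
        Multiset.card_zero, Multiset.card_add, Finset.card_val] at hcard
      omega
    | cons H f' =>
      have hFH : F = H := by
        apply Finset.Subset.antisymm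
        · intro s hs
          exact (h'.face H (by simp)).closed _ _ (fun s hs => h'.mem_faceSum_cons.1 hs) hπ.symm
            hcard.symm s (h.mem_faceSum_cons.2 hs)
        · intro s hs
          exact (h.face F (by simp)).closed _ _ (fun s hs => h.mem_faceSum_cons.1 hs) hπ
            hcard s (h'.mem_faceSum_cons.2 hs)
      subst hFH
      simp only [← Multiset.cons_coe, faceSum_cons, map_add, add_right_inj, Multiset.card_add]
        at hπ hcard
      rw [ih (h.sublist (List.sublist_cons_self _ _)) (h'.sublist (List.sublist_cons_self _ _))
        hπ hcard]

/-- As long as possible, rewrite the multiset at constant value and size so that a full copy of `F`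
splits off. When this stops, all but a bounded part is carried by a proper subface, to which
induction applies. -/
theorem IsFace.exists_flag [Finite α] {F : Finset α} (hF : IsFace π F) :
    ∃ C : ℕ, ∀ a : Multiset α, (∀ s ∈ a, s ∈ F) → ∃ (f : List (Finset α)) (r : Multiset α),
      IsFlag π f ∧ (∀ H ∈ f, H ⊆ F) ∧ r.card ≤ C ∧ π a = π (faceSum f) + π r ∧
        a.card = (faceSum (f : Multiset (Finset α))).card + r.card := by
  classical
  have := Fintype.ofFinite α
  induction F using Finset.strongInduction with
  | H F ih =>
  choose! B hB using ih
  let U : Set (Multiset α) := {a | ∃ b, π a = π b ∧ a.card = b.card ∧ F.val ≤ b}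
  obtain ⟨C, hC⟩ := exists_bounded_part U
  -- `C` pays for the part discarded when leaving `F`; the sum bounds the remainder for whichever
  -- subface comes next.
  refine ⟨C + ∑ H : Finset α, B H, fun a => ?_⟩
  induction hn : a.card using Nat.strong_induction_on generalizing a with
  | _ n ihn =>
  subst hn
  intro ha
  by_cases hU : ∃ u ∈ U, u ≤ a
  · obtain ⟨u, ⟨b, hub, hcub, hFb⟩, hua⟩ := hU
    obtain ⟨e, rfl⟩ := Multiset.le_iff_exists_add.1 hua
    obtain ⟨d, rfl⟩ := Multiset.le_iff_exists_add.1 hFb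
    have hpi : π (u + e) = π (F.val + d + e) := by simp only [map_add] at hub ⊢; rw [hub]
    have hca : (u + e).card = (F.val + d + e).card := by
      simp only [Multiset.card_add] at hcub ⊢; omega
    have hde : ∀ s ∈ d + e, s ∈ F := fun s hs =>
      hF.closed _ _ ha hpi hca s (by rw [add_assoc]; exact Multiset.mem_add.2 (Or.inr hs))
    have hpos := hF.nonempty.card_pos
    obtain ⟨f, r, hf, hfF, hr, hπ, hc⟩ := ihn (d + e).card (by
      rw [hca]; simp only [Multiset.card_add, Finset.card_val]; omega) (d + e) rfl hde
    refine ⟨F :: f, r, ⟨?_, List.pairwise_cons.2 ⟨hfF, hf.pairwise⟩⟩, ?_, hr, ?_, ?_⟩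
    · intro H hH
      rcases List.mem_cons.1 hH with rfl | hH
      exacts [hF, hf.face H hH]
    · intro H hH
      rcases List.mem_cons.1 hH with rfl | hH
      exacts [subset_rfl, hfF H hH]
    · rw [← Multiset.cons_coe, faceSum_cons, map_add π F.val, add_assoc, ← hπ, hpi, add_assoc,
        map_add]
    · rw [← Multiset.cons_coe, faceSum_cons, Multiset.card_add F.val, add_assoc, ← hc, hca,
        add_assoc, Multiset.card_add]
  · push Not at hU
    obtain ⟨r, a', rfl, hr, hd⟩ := hC a hU
    rcases Finset.eq_empty_or_nonempty a'.toFinset with h0 | hne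
    · rw [Multiset.toFinset_eq_empty] at h0
      subst h0
      exact ⟨[], r, .nil, by simp, by omega, by simp, by simp⟩
    · have hA : ∀ s, s ∈ a'.toFinset → s ∈ F := fun s hs =>
        ha s (Multiset.mem_add.2 (Or.inr (Multiset.mem_toFinset.1 hs)))
      obtain ⟨H, hH, hAH, b, c, hb, hπ, hc, hHc⟩ := exists_face hne
        fun d hd' => hF.tight d fun s hs => hA s (hd' s hs)
      have hHF : H ⊆ F := fun s hs => hF.closed b c (fun s hs => hA s (hb s hs)) hπ hc s
        (Multiset.mem_of_le hHc hs)
      -- If `H` were all of `F`, then `b`, carried by the letters of `a'`, would lie in `U`.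
      have hne' : H ≠ F := fun h => hd b (fun s hs => Multiset.mem_toFinset.1 (hb s hs))
        ⟨c, hπ, hc, h ▸ hHc⟩
      obtain ⟨f, r', hf, hfH, hr', hπ', hc'⟩ := hB H (hHF.ssubset_of_ne hne') hH a'
        fun s hs => hAH (Multiset.mem_toFinset.2 hs)
      refine ⟨f, r + r', hf, fun I hI => (hfH I hI).trans hHF, ?_, ?_, ?_⟩
      · have := Finset.single_le_sum (f := B) (fun _ _ => Nat.zero_le _) (Finset.mem_univ H)
        rw [Multiset.card_add]
        omega
      · rw [map_add, hπ', map_add]; abel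
      · rw [Multiset.card_add, hc', Multiset.card_add]; omega

/-- Avoiding the set of non-tight multisets, a tight multiset is, up to a bounded part, carried by
letters that support only tight multisets; these letters span a face. -/
theorem exists_flag_of_isTight [Finite α] (π : Multiset α →+ M) :
    ∃ C : ℕ, ∀ a : Multiset α, IsTight π a → ∃ (f : List (Finset α)) (r : Multiset α),
      IsFlag π f ∧ r.card ≤ C ∧ π a = π (faceSum f) + π r ∧
        a.card = (faceSum (f : Multiset (Finset α))).card + r.card := by
  classical
  have := Fintype.ofFinite α
  choose! B hB using fun F (hF : IsFace π F) => hF.exists_flag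
  obtain ⟨C, hC⟩ := exists_bounded_part {a | ¬ IsTight π a}
  refine ⟨C + ∑ H : Finset α, B H, fun a ha => ?_⟩
  obtain ⟨r, a', rfl, hr, hd⟩ := hC a fun u hu hua => hu (ha.mono hua)
  rcases Finset.eq_empty_or_nonempty a'.toFinset with h0 | hne
  · rw [Multiset.toFinset_eq_empty] at h0
    subst h0
    exact ⟨[], r, .nil, by omega, by simp, by simp⟩
  · obtain ⟨H, hH, hAH, -⟩ := exists_face hne fun d hd' =>
      not_not.1 (hd d fun s hs => Multiset.mem_toFinset.1 (hd' s hs))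
    obtain ⟨f, r', hf, -, hr', hπ', hc'⟩ := hB H hH a'
      fun s hs => hAH (Multiset.mem_toFinset.2 hs)
    refine ⟨f, r + r', hf, ?_, ?_, ?_⟩
    · have := Finset.single_le_sum (f := B) (fun _ _ => Nat.zero_le _) (Finset.mem_univ H)
      rw [Multiset.card_add]
      omega
    · rw [map_add, hπ', map_add]; abel
    · rw [Multiset.card_add, hc', Multiset.card_add]; omega

/-! ### Flags with nearby values -/

/-- Below each pair of flags with difference `w` lies such a pair of bounded size. Removing it
leaves two flags of equal value, which coincide by uniqueness, so the multiplicities differ only by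
those of the bounded pair. -/
theorem exists_count_le_of_flags [Finite α] [DecidableEq α] (π : Multiset α →+ M) (w : M) :
    ∃ K : ℕ, ∀ f f' : List (Finset α), IsFlag π f → IsFlag π f' →
      π (faceSum f) = π (faceSum f') + w →
        ∀ F, f.count F ≤ f'.count F + K ∧ f'.count F ≤ f.count F + K := by
  obtain ⟨K, hK⟩ := exists_small_le_of_wellQuasiOrdered
    {p : Multiset (Finset α) × Multiset (Finset α) | ∃ f f' : List (Finset α),
      p = (↑f, ↑f') ∧ IsFlag π f ∧ IsFlag π f' ∧ π (faceSum f) = π (faceSum f') + w}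
    (fun p => p.1.card + p.2.card)
  refine ⟨K, fun f f' hf hf' hw F => ?_⟩
  obtain ⟨-, ⟨g, g', rfl, hg, hg', hgw⟩, hle, hc⟩ := hK (↑f, ↑f') ⟨f, f', rfl, hf, hf', hw⟩
  obtain ⟨h1, h2⟩ := hle
  have e1 : (f : Multiset (Finset α)) = g + (f.diff g : List _) := by
    rw [← Multiset.coe_sub, add_tsub_cancel_of_le h1]
  have e2 : (f' : Multiset (Finset α)) = g' + (f'.diff g' : List _) := by
    rw [← Multiset.coe_sub, add_tsub_cancel_of_le h2]
  have heq : f.diff g = f'.diff g' := by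
    refine (hf.sublist (List.diff_sublist _ _)).eq_of_map_eq
      (hf'.sublist (List.diff_sublist _ _)) ?_
    rw [e1, e2, faceSum_add, faceSum_add, map_add, map_add, hgw, add_right_comm] at hw
    exact add_left_cancel (add_right_cancel hw)
  have c1 := congrArg (Multiset.count F) e1
  have c2 := congrArg (Multiset.count F) e2
  rw [Multiset.count_add] at c1 c2
  rw [heq] at c1
  have := Multiset.count_le_card F (g : Multiset _)
  have := Multiset.count_le_card F (g' : Multiset _)
  simp only [Multiset.coe_count, Multiset.coe_card] at *
  omega

/-- Prefixes of two lists that are sorted by the same antisymmetric relation and have nearly the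
same entries are nearly comparable. -/
theorem count_take_le_or_le {β : Type*} [DecidableEq β] {R : β → β → Prop}
    (hR : ∀ x y, R x y → R y x → x = y) {f f' : List β} (hf : f.Pairwise R) (hf' : f'.Pairwise R)
    {K : ℕ} (h : ∀ x, f.count x ≤ f'.count x + K ∧ f'.count x ≤ f.count x + K) (j j' : ℕ) :
    (∀ x, (f.take j).count x ≤ (f'.take j').count x + K) ∨
      ∀ x, (f'.take j').count x ≤ (f.take j).count x + K := by
  by_contra! hcon
  obtain ⟨⟨x, hx⟩, y, hy⟩ := hcon
  have key : ∀ (f : List β) (j : ℕ) (x : β),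
      f.count x = (f.take j).count x + (f.drop j).count x := fun f j x => by
    rw [← List.count_append, List.take_append_drop]
  have a1 := key f j x
  have a2 := key f j y
  have b1 := key f' j' x
  have b2 := key f' j' y
  have hx' := h x
  have hy' := h y
  rw [← List.take_append_drop j f, List.pairwise_append] at hf
  rw [← List.take_append_drop j' f', List.pairwise_append] at hf'
  -- As total multiplicities agree up to `K`, an excess of `x` in the first prefix leaves an `x`
  -- after the second prefix, and symmetrically for `y`. Sortedness of both lists then gives `R x y`
  -- and `R y x`.
  have hxy : R x y := hf.2.2 x (List.count_pos_iff.1 (by omega)) y (List.count_pos_iff.1 (by omega))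
  have hyx : R y x :=
    hf'.2.2 y (List.count_pos_iff.1 (by omega)) x (List.count_pos_iff.1 (by omega))
  obtain rfl := hR x y hxy hyx
  omega

theorem card_faceSum_sub_le [Fintype α] [DecidableEq α] {X Y : Multiset (Finset α)} {K : ℕ}
    (h : ∀ F, X.count F ≤ Y.count F + K) :
    (faceSum (X - Y)).card ≤ K * (faceSum (Finset.univ : Finset (Finset α)).val).card := by
  have hle : X - Y ≤ K • (Finset.univ : Finset (Finset α)).val :=
      Multiset.le_iff_count.2 fun F => by
    have := h F
    rw [Multiset.count_sub, Multiset.count_nsmul,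
      Multiset.count_eq_one_of_mem Finset.univ.nodup (Finset.mem_univ F)]
    omega
  obtain ⟨e, he⟩ := Multiset.le_iff_exists_add.1 hle
  have h1 := congrArg (fun m => (faceSum m).card) he
  have h2 : ∀ n : ℕ, ∀ m : Multiset (Finset α), (faceSum (n • m)).card = n * (faceSum m).card := by
    intro n m
    induction n with
    | zero => simp
    | succ n ih => rw [succ_nsmul, faceSum_add, Multiset.card_add, ih, Nat.succ_mul]
  simp only [h2, faceSum_add, Multiset.card_add] at h1
  omega

/-- Prefixes of flags whose values differ by `w` differ by multisets of at most `K + E` letters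
if their sizes differ by at most `E`. -/
def FlagPrefixesWithin (π : Multiset α →+ M) (w : M) (K : ℕ) : Prop :=
  ∀ f f' : List (Finset α), IsFlag π f → IsFlag π f' →
    π (faceSum f) = π (faceSum f') + w → ∀ j j' E : ℕ,
      (faceSum (f.take j : Multiset (Finset α))).card ≤
        (faceSum (f'.take j' : Multiset (Finset α))).card + E →
      (faceSum (f'.take j' : Multiset (Finset α))).card ≤
        (faceSum (f.take j : Multiset (Finset α))).card + E →
      ∃ p q : Multiset α, p.card ≤ K + E ∧ q.card ≤ K + E ∧
        faceSum (f.take j : Multiset (Finset α)) + p =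
          faceSum (f'.take j' : Multiset (Finset α)) + q

theorem FlagPrefixesWithin.mono {w : M} {K L : ℕ} (h : FlagPrefixesWithin π w K) (hKL : K ≤ L) :
    FlagPrefixesWithin π w L := fun f f' hf hf' hw j j' E h1 h2 => by
  obtain ⟨p, q, hp, hq, hpq⟩ := h f f' hf hf' hw j j' E h1 h2
  exact ⟨p, q, by omega, by omega, hpq⟩

theorem exists_flagPrefixesWithin [Finite α] (π : Multiset α →+ M) (w : M) :
    ∃ K : ℕ, FlagPrefixesWithin π w K := by
  classical
  have := Fintype.ofFinite α
  obtain ⟨K, hK⟩ := exists_count_le_of_flags π w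
  refine ⟨K * (faceSum (Finset.univ : Finset (Finset α)).val).card,
    fun f f' hf hf' hw j j' E h1 h2 => ?_⟩
  generalize hD : (faceSum (Finset.univ : Finset (Finset α)).val).card = D
  set X : Multiset (Finset α) := ↑(f.take j) with hX
  set Y : Multiset (Finset α) := ↑(f'.take j') with hY
  have e : faceSum X + faceSum (Y - X) = faceSum Y + faceSum (X - Y) := by
    rw [← faceSum_add, ← faceSum_add, add_comm X, add_comm Y]
    exact congrArg _ (Multiset.union_comm Y X)
  have ec := congrArg Multiset.card e
  simp only [Multiset.card_add] at ec
  -- Near-comparability bounds one of the two differences by `K * D`; the size hypotheses bound the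
  -- other by `K * D + E`.
  refine ⟨faceSum (Y - X), faceSum (X - Y), ?_, ?_, e⟩ <;>
  · rcases count_take_le_or_le (fun F H h1 h2 => Finset.Subset.antisymm h2 h1) hf.pairwise
      hf'.pairwise (hK f f' hf hf' hw) j j' with h | h
    · have := card_faceSum_sub_le (X := X) (Y := Y) (K := K) fun F => by
        simpa only [hX, hY, Multiset.coe_count] using h F
      rw [hD] at this
      omega
    · have := card_faceSum_sub_le (X := Y) (Y := X) (K := K) fun F => by
        simpa only [hX, hY, Multiset.coe_count] using h F
      rw [hD] at this
      omega

end CayleyGeom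

namespace CayleyGeom

variable {G : Type*} [Group G] {X : Set G}

/-! ### Words and word length -/

@[simp] theorem value_nil : value ([] : List X) = 1 := rfl

@[simp] theorem value_cons (x : X) (W : List X) : value (x :: W) = x * value W := by simp [value]

@[simp] theorem value_append (W V : List X) : value (W ++ V) = value W * value V := by
  simp [value]

theorem wordLength_value_le (W : List X) : wordLength X (value W) ≤ W.length :=
  Nat.sInf_le ⟨W, rfl, rfl⟩

theorem isGeodesicWord_iff {W : List X} : IsGeodesicWord W ↔ W.length ≤ wordLength X (value W) := by
  constructor
  · intro h
    obtain ⟨V, hV, hl⟩ := Nat.sInf_mem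
      (s := {n : ℕ | ∃ V : List X, value V = value W ∧ V.length = n})
      ⟨_, W, rfl, rfl⟩
    have := h ⟨1, V⟩ rfl (by simp [Path.terminus, hV])
    exact this.trans hl.le
  · intro h q hq1 hq2
    have : value q.label = value W := by simpa [Path.terminus, hq1] using hq2
    exact h.trans (this ▸ wordLength_value_le q.label)

theorem Path.isGeodesic_iff {p : Path X} : p.IsGeodesic ↔ IsGeodesicWord p.label := by
  constructor
  · intro h q hq1 hq2
    exact h ⟨p.start, q.label⟩ rfl (by simpa [Path.terminus, hq1] using hq2)
  · intro h q hq1 hq2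
    exact h ⟨1, q.label⟩ rfl (by simpa [Path.terminus, hq1] using hq2)

namespace IsFiniteSymmGenSet

theorem exists_word (hX : IsFiniteSymmGenSet X) (g : G) :
    ∃ W : List X, value W = g ∧ W.length = wordLength X g := by
  refine Nat.sInf_mem (s := {n : ℕ | ∃ W : List X, value W = g ∧ W.length = n}) ?_
  obtain ⟨l, hl, rfl⟩ := Submonoid.exists_list_of_mem_closure
    (show g ∈ Submonoid.closure (X ∪ X⁻¹) by
      rw [← Subgroup.closure_toSubmonoid, hX.closure_eq_top]; trivial)
  have hl' : ∀ x ∈ l, x ∈ X := fun x hx =>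
    (hl x hx).elim id fun h => by simpa using hX.inv_mem _ h
  lift l to List X using hl'
  exact ⟨_, l, rfl, rfl⟩

theorem wordLength_mul_le (hX : IsFiniteSymmGenSet X) (g h : G) :
    wordLength X (g * h) ≤ wordLength X g + wordLength X h := by
  obtain ⟨W, rfl, hW⟩ := hX.exists_word g
  obtain ⟨V, rfl, hV⟩ := hX.exists_word h
  rw [← hW, ← hV, ← List.length_append, ← value_append]
  exact wordLength_value_le _

theorem wordLength_inv_le (hX : IsFiniteSymmGenSet X) (g : G) :
    wordLength X g⁻¹ ≤ wordLength X g := by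
  obtain ⟨W, rfl, hW⟩ := hX.exists_word g
  rw [← hW]
  clear hW
  induction W with
  | nil => simpa using wordLength_value_le (X := X) []
  | cons x W ih =>
    rw [value_cons, mul_inv_rev, List.length_cons]
    refine (hX.wordLength_mul_le _ _).trans (Nat.add_le_add ih ?_)
    simpa using wordLength_value_le (X := X) [⟨_, hX.inv_mem _ x.2⟩]

theorem wordLength_inv (hX : IsFiniteSymmGenSet X) (g : G) : wordLength X g⁻¹ = wordLength X g :=
  (hX.wordLength_inv_le g).antisymm (by simpa using hX.wordLength_inv_le g⁻¹)

theorem dist_triangle (hX : IsFiniteSymmGenSet X) (g h k : G) :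
    dist X g k ≤ dist X g h + dist X h k := by
  simpa [dist, mul_assoc] using hX.wordLength_mul_le (g⁻¹ * h) (h⁻¹ * k)

theorem dist_comm (hX : IsFiniteSymmGenSet X) (g h : G) :
    dist X g h = dist X h g := by
  rw [dist, dist, ← hX.wordLength_inv]; simp

theorem finite_ball (hX : IsFiniteSymmGenSet X) (n : ℕ) : {g : G | wordLength X g ≤ n}.Finite := by
  have := hX.finite.to_subtype
  refine ((List.finite_length_le X n).image value).subset fun g hg => ?_
  obtain ⟨W, rfl, hW⟩ := hX.exists_word g
  exact ⟨W, hW.le.trans hg, rfl⟩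

end IsFiniteSymmGenSet

@[simp] theorem wordLength_one : wordLength X (1 : G) = 0 :=
  Nat.le_zero.1 (wordLength_value_le (X := X) [])

@[simp] theorem dist_self (g : G) : dist X g g = 0 := by simp [dist]

theorem dist_mul_left (k g h : G) : dist X (k * g) (k * h) = dist X g h := by
  simp [dist, mul_assoc]

theorem dist_mul_right_value_le (g : G) (W : List X) : dist X g (g * value W) ≤ W.length := by
  simpa [dist] using wordLength_value_le W

/-! ### Generating sets adapted to an abelian normal subgroup -/

/-- A finite symmetric generating set whose part in the normal subgroup `N` is invariant under
conjugation, and for which words of `m` letters outside `N` are never geodesic. -/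
structure IsAdaptedGenSet (N : Subgroup G) (Z : Set G) (m : ℕ) : Prop
    extends IsFiniteSymmGenSet Z where
  conj_mem : ∀ g : G, ∀ z ∈ Z, z ∈ N → g * z * g⁻¹ ∈ Z
  wordLength_lt : ∀ W : List Z, (∀ z ∈ W, (z : G) ∉ N) → W.length = m →
    wordLength Z (value W) < m

/-- The new inner letters are all conjugates of those products of at most `m` old letters that lie
in `N`. They are finitely many because `N` centralizes itself, so conjugation factors through the
finite quotient. -/
theorem exists_isAdaptedGenSet (N : Subgroup G) [hN : N.Normal] [N.FiniteIndex]
    [IsMulCommutative N] {Y : Set G} (hYfin : Y.Finite) (hYgen : Subgroup.closure Y = ⊤) :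
    ∃ Z m, Y ⊆ Z ∧ IsAdaptedGenSet N Z m := by
  set m := Nat.card (G ⧸ N) with hm
  have hm0 : 0 < m := Nat.card_pos
  let Y' : Set G := Y ∪ Y⁻¹
  have hY' : Y'.Finite := hYfin.union hYfin.inv
  have hinv : ∀ y ∈ Y', y⁻¹ ∈ Y' := fun y hy => by
    rcases hy with hy | hy
    · exact Or.inr (by simpa using hy)
    · exact Or.inl hy
  let S : Set G := {x | ∃ g : G, ∃ l : List G, (∀ y ∈ l, y ∈ Y') ∧ l.length ≤ m ∧ l.prod ∈ N ∧
    x = g * l.prod * g⁻¹}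
  have hSN : ∀ x ∈ S, x ∈ N := by
    rintro _ ⟨g, l, -, -, hl, rfl⟩
    exact hN.conj_mem _ hl g
  have hconj : ∀ g : G, ∀ x ∈ S, g * x * g⁻¹ ∈ S := by
    rintro g _ ⟨k, l, h1, h2, h3, rfl⟩
    exact ⟨g * k, l, h1, h2, h3, by group⟩
  have hSfin : S.Finite := by
    have := hY'.to_subtype
    refine ((Set.toFinite (Set.univ : Set (G ⧸ N))).prod (List.finite_length_le Y' m)).image
      (fun p => p.1.out * (p.2.map Subtype.val).prod * (p.1.out)⁻¹) |>.subset ?_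
    rintro _ ⟨g, l, h1, h2, h3, rfl⟩
    lift l to List Y' using h1
    refine ⟨(↑g, l), ⟨trivial, by simpa using h2⟩, ?_⟩
    obtain ⟨n, hn⟩ := QuotientGroup.mk_out_eq_mul N g
    have hc : (n : G) * (l.map Subtype.val).prod = (l.map Subtype.val).prod * n :=
      congrArg Subtype.val (mul_comm' n ⟨_, h3⟩)
    simp only [hn]
    calc g * n * (l.map Subtype.val).prod * (g * n)⁻¹
        = g * (n * (l.map Subtype.val).prod) * (n : G)⁻¹ * g⁻¹ := by group
      _ = g * (l.map Subtype.val).prod * g⁻¹ := by rw [hc]; group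
  have hSinv : ∀ x ∈ S, x⁻¹ ∈ S := by
    rintro _ ⟨g, l, h1, h2, h3, rfl⟩
    refine ⟨g, (l.map (·⁻¹)).reverse, fun y hy => ?_, by simpa using h2, ?_, ?_⟩
    · simp only [List.mem_reverse, List.mem_map] at hy
      obtain ⟨z, hz, rfl⟩ := hy
      exact hinv z (h1 z hz)
    · rw [← List.prod_inv_reverse]; exact N.inv_mem h3
    · rw [← List.prod_inv_reverse]; group
  have hYZ : Y ⊆ (Y' \ N) ∪ S := fun y hy => by
    by_cases hyN : y ∈ N
    · exact Or.inr ⟨1, [y], by simp [Y', hy], by simp; omega, by simpa using hyN,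
        by simp⟩
    · exact Or.inl ⟨Or.inl hy, hyN⟩
  refine ⟨(Y' \ N) ∪ S, m, hYZ, ⟨⟨(hY'.subset Set.sdiff_subset).union hSfin, ?_, ?_⟩, ?_, ?_⟩⟩
  · rintro x (⟨hx, hxN⟩ | hx)
    · exact Or.inl ⟨hinv x hx, fun h => hxN (by simpa using N.inv_mem h)⟩
    · exact Or.inr (hSinv x hx)
  · exact top_le_iff.1 (hYgen ▸ Subgroup.closure_mono hYZ)
  · rintro g z (⟨-, hz⟩ | hz) hzN
    exacts [absurd hzN hz, Or.inr (hconj g z hz)]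
  · intro W hW hlen
    -- Pigeonhole: two of the `m + 1` prefixes lie in the same coset of `N`, so the subword between
    -- them represents an inner letter. It has at least two letters, as each letter is outside `N`;
    -- replacing it by that inner letter shortens the word.
    have hni : ¬ Function.Injective
        (fun i : Fin (m + 1) => (QuotientGroup.mk (value (W.take i)) : G ⧸ N)) := fun h => by
      have := Nat.card_le_card_of_injective _ h
      simp [← hm] at this
    rw [Function.not_injective_iff] at hni
    obtain ⟨i, j, hij, hne⟩ := hni
    wlog hlt : i < j generalizing i j
    · exact this j i hij.symm hne.symm (lt_of_le_of_ne (not_lt.1 hlt) hne.symm)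
    have hlt' : (i : ℕ) < j := hlt
    have hjm := j.2
    have e1 : W.take j = W.take i ++ (W.take j).drop i := by
      conv_lhs => rw [← List.take_append_drop i (W.take j), List.take_take, min_eq_left hlt'.le]
    set V := (W.take j).drop i with hV
    have hVW : ∀ z ∈ V, z ∈ W := fun z hz => List.mem_of_mem_take (List.mem_of_mem_drop hz)
    have hVlen : V.length = j - i := by simp [hV, hlen]; omega
    have hVN : value V ∈ N := by
      have := QuotientGroup.eq.1 hij
      rw [e1] at this
      simpa using this
    have hVS : value V ∈ S := by
      refine ⟨1, V.map Subtype.val, fun y hy => ?_, by simp [hVlen]; omega, hVN, by simp [value]⟩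
      obtain ⟨z, hz, rfl⟩ := List.mem_map.1 hy
      rcases z.2 with h | h
      · exact h.1
      · exact absurd (hSN _ h) (hW z (hVW z hz))
    have h2 : 2 ≤ V.length := by
      by_contra hcon
      obtain ⟨z, hz⟩ := List.length_eq_one_iff.1 (show V.length = 1 by omega)
      rw [hz] at hVN
      exact hW z (hVW z (by simp [hz])) (by simpa using hVN)
    have e2 : value W = value (W.take i ++ [⟨value V, Or.inr hVS⟩] ++ W.drop j) := by
      conv_lhs => rw [← List.take_append_drop j W, e1]
      simp
    rw [e2]
    refine (wordLength_value_le _).trans_lt ?_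
    simp [hlen]
    omega

end CayleyGeom

namespace CayleyGeom

open scoped IsMulCommutative

theorem exists_uniform_bound {ι : Type*} {s : Set ι} (hs : s.Finite) {P : ι → ℕ → Prop}
    (hmono : ∀ i m n, m ≤ n → P i m → P i n) (h : ∀ i ∈ s, ∃ C, P i C) :
    ∃ C, ∀ i ∈ s, P i C := by
  choose! C hC using h
  obtain ⟨B, hB⟩ := (hs.image C).bddAbove
  exact ⟨B, fun i hi => hmono i _ _ (hB ⟨i, hi, rfl⟩) (hC i hi)⟩

variable {G : Type*} [Group G]

/-! ### Letters in the abelian subgroup -/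

/-- The letters of `Z` that lie in `N`. -/
abbrev InnerLetter (N : Subgroup G) (Z : Set G) := {z : Z // (z : G) ∈ N}

section InnerValue

variable (N : Subgroup G) (Z : Set G) [IsMulCommutative N]

/-- The element of `N` represented by a multiset of letters in `N`. -/
noncomputable def innerHom : Multiset (InnerLetter N Z) →+ Additive N :=
  Multiset.sumAddMonoidHom.comp
    (Multiset.mapAddMonoidHom fun z => Additive.ofMul (⟨z.1, z.2⟩ : N))

end InnerValue

variable {N : Subgroup G} {Z : Set G} [IsMulCommutative N]

/-- The element of `G` represented by a multiset of letters in `N`. -/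
noncomputable def innerValue (a : Multiset (InnerLetter N Z)) : G := (innerHom N Z a).toMul

theorem innerValue_mem (a : Multiset (InnerLetter N Z)) : innerValue a ∈ N :=
  (innerHom N Z a).toMul.2

@[simp] theorem innerValue_zero : innerValue (0 : Multiset (InnerLetter N Z)) = 1 := by
  simp [innerValue]

theorem innerValue_add (a b : Multiset (InnerLetter N Z)) :
    innerValue (a + b) = innerValue a * innerValue b := by
  simp [innerValue]

@[simp] theorem innerValue_cons (z : InnerLetter N Z) (a : Multiset (InnerLetter N Z)) :
    innerValue (z ::ₘ a) = z.1 * innerValue a := by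
  simp [innerValue, innerHom]

theorem innerHom_eq_iff {a b : Multiset (InnerLetter N Z)} :
    innerHom N Z a = innerHom N Z b ↔ innerValue a = innerValue b := by
  simp [innerValue]

theorem mul_comm_of_mem {x y : G} (hx : x ∈ N) (hy : y ∈ N) : x * y = y * x :=
  congrArg Subtype.val (mul_comm' (⟨x, hx⟩ : N) ⟨y, hy⟩)

theorem value_map_val (l : List (InnerLetter N Z)) :
    value (l.map Subtype.val) = innerValue (l : Multiset (InnerLetter N Z)) := by
  induction l with
  | nil => simp
  | cons z l ih => rw [← Multiset.cons_coe, innerValue_cons, List.map_cons, value_cons, ih]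

theorem wordLength_innerValue_le (a : Multiset (InnerLetter N Z)) :
    wordLength Z (innerValue a) ≤ a.card := by
  induction a using Quotient.inductionOn with
  | h l =>
    change wordLength Z (innerValue (l : Multiset (InnerLetter N Z))) ≤ _
    rw [← value_map_val]
    simpa using wordLength_value_le (l.map Subtype.val)

namespace IsAdaptedGenSet

variable [hN : N.Normal] {m : ℕ}

omit [IsMulCommutative N] hN in
theorem finite_innerLetter (hZ : IsAdaptedGenSet N Z m) : Finite (InnerLetter N Z) :=
  have := hZ.finite.to_subtype
  inferInstance

/-- Conjugation as a map on the letters in `N`. -/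
def conj (hZ : IsAdaptedGenSet N Z m) (g : G) (z : InnerLetter N Z) : InnerLetter N Z :=
  ⟨⟨g * z.1 * g⁻¹, hZ.conj_mem g _ z.1.2 z.2⟩, hN.conj_mem _ z.2 g⟩

omit [IsMulCommutative N] in
theorem conj_conj (hZ : IsAdaptedGenSet N Z m) (g h : G) (z : InnerLetter N Z) :
    hZ.conj g (hZ.conj h z) = hZ.conj (g * h) z := by
  apply Subtype.ext; apply Subtype.ext
  simp [conj, mul_assoc]

omit [IsMulCommutative N] in
theorem conj_one (hZ : IsAdaptedGenSet N Z m) (z : InnerLetter N Z) : hZ.conj 1 z = z := by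
  apply Subtype.ext; apply Subtype.ext
  simp [conj]

omit [IsMulCommutative N] in
theorem map_conj_map_conj (hZ : IsAdaptedGenSet N Z m) (g h : G)
    (a : Multiset (InnerLetter N Z)) :
    (a.map (hZ.conj h)).map (hZ.conj g) = a.map (hZ.conj (g * h)) := by
  simp [hZ.conj_conj]

theorem innerValue_map_conj (hZ : IsAdaptedGenSet N Z m) (g : G)
    (a : Multiset (InnerLetter N Z)) :
    innerValue (a.map (hZ.conj g)) = g * innerValue a * g⁻¹ := by
  induction a using Multiset.induction_on with
  | empty => simp
  | cons z a ih =>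
    rw [Multiset.map_cons, innerValue_cons, innerValue_cons, ih]
    simp [conj, mul_assoc]

/-! ### Pushing the letters outside `N` to the right -/

open scoped Classical in
/-- The letters in `N` of a word, after pushing all other letters to the right. -/
noncomputable def innerPart (hZ : IsAdaptedGenSet N Z m) : List Z → Multiset (InnerLetter N Z)
  | [] => 0
  | z :: W => if h : (z : G) ∈ N then ⟨z, h⟩ ::ₘ innerPart hZ W
      else (innerPart hZ W).map (hZ.conj z)

open scoped Classical in
/-- The letters outside `N` of a word. -/
noncomputable def _root_.CayleyGeom.outerPart (N : Subgroup G) (W : List Z) : List Z :=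
  W.filter fun z => (z : G) ∉ N

omit [IsMulCommutative N] hN in
@[simp] theorem _root_.CayleyGeom.outerPart_append (W V : List Z) :
    outerPart N (W ++ V) = outerPart N W ++ outerPart N V := by
  simp [outerPart]

omit [IsMulCommutative N] in
theorem innerPart_cons_of_mem (hZ : IsAdaptedGenSet N Z m) {z : Z} (h : (z : G) ∈ N)
    (W : List Z) : hZ.innerPart (z :: W) = ⟨z, h⟩ ::ₘ hZ.innerPart W := by
  simp [innerPart, h]

omit [IsMulCommutative N] in
theorem innerPart_cons_of_notMem (hZ : IsAdaptedGenSet N Z m) {z : Z} (h : (z : G) ∉ N)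
    (W : List Z) : hZ.innerPart (z :: W) = (hZ.innerPart W).map (hZ.conj z) := by
  simp [innerPart, h]

theorem value_eq (hZ : IsAdaptedGenSet N Z m) (W : List Z) :
    value W = innerValue (hZ.innerPart W) * value (outerPart N W) := by
  induction W with
  | nil => simp [innerPart, outerPart]
  | cons z W ih =>
    by_cases h : (z : G) ∈ N
    · rw [hZ.innerPart_cons_of_mem h, value_cons, ih, innerValue_cons]
      simp [outerPart, h, mul_assoc]
    · rw [hZ.innerPart_cons_of_notMem h, value_cons, ih, hZ.innerValue_map_conj]
      simp [outerPart, h, mul_assoc]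

omit [IsMulCommutative N] in
theorem length_eq (hZ : IsAdaptedGenSet N Z m) (W : List Z) :
    W.length = (hZ.innerPart W).card + (outerPart N W).length := by
  induction W with
  | nil => simp [innerPart, outerPart]
  | cons z W ih =>
    by_cases h : (z : G) ∈ N
    · rw [hZ.innerPart_cons_of_mem h]
      simp [outerPart, h] at ih ⊢
      omega
    · rw [hZ.innerPart_cons_of_notMem h]
      simp [outerPart, h] at ih ⊢
      omega

omit [IsMulCommutative N] in
theorem innerPart_append (hZ : IsAdaptedGenSet N Z m) (W V : List Z) :
    hZ.innerPart (W ++ V) =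
      hZ.innerPart W + (hZ.innerPart V).map (hZ.conj (value (outerPart N W))) := by
  induction W with
  | nil => simp [innerPart, outerPart, hZ.conj_one]
  | cons z W ih =>
    by_cases h : (z : G) ∈ N
    · rw [List.cons_append, hZ.innerPart_cons_of_mem h, hZ.innerPart_cons_of_mem h, ih]
      simp [outerPart, h]
    · rw [List.cons_append, hZ.innerPart_cons_of_notMem h, hZ.innerPart_cons_of_notMem h, ih,
        Multiset.map_add, hZ.map_conj_map_conj]
      simp [outerPart, h]

/-- Once the outer letters are adjacent, the first `m` of them can be replaced by a shorter word. -/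
theorem wordLength_lt_of_outerPart (hZ : IsAdaptedGenSet N Z m) {W : List Z}
    (hW : m ≤ (outerPart N W).length) : wordLength Z (value W) < W.length := by
  have h1 := hZ.wordLength_lt ((outerPart N W).take m)
    (fun z hz => by simpa [outerPart] using (List.mem_filter.1 (List.mem_of_mem_take hz)).2)
    (by simpa using hW)
  have h2 := wordLength_value_le ((outerPart N W).drop m)
  have h3 := hZ.wordLength_mul_le (value ((outerPart N W).take m)) (value ((outerPart N W).drop m))
  rw [← value_append, List.take_append_drop] at h3
  have h4 := hZ.wordLength_mul_le (innerValue (hZ.innerPart W)) (value (outerPart N W))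
  rw [← hZ.value_eq] at h4
  have h5 := wordLength_innerValue_le (hZ.innerPart W)
  rw [hZ.length_eq W]
  rw [List.length_drop] at h2
  omega

theorem length_outerPart_lt (hZ : IsAdaptedGenSet N Z m) {W : List Z} (hW : IsGeodesicWord W) :
    (outerPart N W).length < m := by
  by_contra! h
  exact absurd (hZ.wordLength_lt_of_outerPart h) (not_lt.2 (isGeodesicWord_iff.1 hW))

omit hN in
theorem wordLength_innerValue_add_mul_lt (hZ : IsAdaptedGenSet N Z m)
    {a b : Multiset (InnerLetter N Z)} {g : G} {n : ℕ} (hab : a ≤ b)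
    (ha : wordLength Z (innerValue a * g) < a.card + n) :
    wordLength Z (innerValue b * g) < b.card + n := by
  obtain ⟨e, rfl⟩ := Multiset.le_iff_exists_add.1 hab
  have h1 := hZ.wordLength_mul_le (innerValue e) (innerValue a * g)
  have h2 := wordLength_innerValue_le e
  rw [add_comm a, innerValue_add, mul_assoc, Multiset.card_add]
  omega

theorem isGeodesicWord_iff_not_lt (hZ : IsAdaptedGenSet N Z m) {W : List Z} :
    IsGeodesicWord W ↔ ¬ wordLength Z (innerValue (hZ.innerPart W) * value (outerPart N W)) <
      (hZ.innerPart W).card + (outerPart N W).length := by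
  rw [← hZ.value_eq, ← hZ.length_eq, isGeodesicWord_iff, not_lt]

-- Dickson's lemma for each of the finitely many words `τ`: a shortening is witnessed by boundedly
-- many inner letters.
omit hN in
theorem exists_bound_of_shorter (hZ : IsAdaptedGenSet N Z m) (n : ℕ) :
    ∃ C, ∀ τ : List Z, τ.length ≤ n → ∀ a : Multiset (InnerLetter N Z),
      wordLength Z (innerValue a * value τ) < a.card + τ.length →
      ∃ b ≤ a, b.card ≤ C ∧ wordLength Z (innerValue b * value τ) < b.card + τ.length := by
  have := hZ.finite.to_subtype
  refine exists_uniform_bound (List.finite_length_le Z n) (P := fun τ C =>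
    ∀ a : Multiset (InnerLetter N Z), wordLength Z (innerValue a * value τ) < a.card + τ.length →
      ∃ b ≤ a, b.card ≤ C ∧ wordLength Z (innerValue b * value τ) < b.card + τ.length)
    (fun τ k l hkl h a ha => ?_) (fun τ _ => ?_)
  · obtain ⟨b, h1, h2, h3⟩ := h a ha
    exact ⟨b, h1, h2.trans hkl, h3⟩
  · obtain ⟨C, hC⟩ := exists_small_le_of_wellQuasiOrdered {a : Multiset (InnerLetter N Z) |
      wordLength Z (innerValue a * value τ) < a.card + τ.length} Multiset.card
    refine ⟨C, fun a ha => ?_⟩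
    obtain ⟨b, h1, h2, h3⟩ := hC a ha
    exact ⟨b, h2, h3, h1⟩

/-! ### The falsification by fellow traveler property -/

/-- `V` lists the letters of `b` in the order in which `W` reads them, each conjugated by the outer
letters before it. Every letter of `W` that `V` skips, whether outer or in `a`, costs at most 2: one
for commuting or conjugating past it and one for the lag of `V`. -/
theorem exists_shadow (hZ : IsAdaptedGenSet N Z m) (W : List Z)
    (a b : Multiset (InnerLetter N Z)) (hab : hZ.innerPart W = a + b) :
    ∃ V : List (InnerLetter N Z), (V : Multiset _) = b ∧ ∀ t,
      dist Z (value (W.take t)) (value ((V.take t).map Subtype.val)) ≤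
        2 * (a.card + (outerPart N W).length) := by
  have step : ∀ (V : List (InnerLetter N Z)) (t : ℕ),
      dist Z (value ((V.take t).map Subtype.val))
        (value ((V.take (t + 1)).map Subtype.val)) ≤ 1 := by
    intro V t
    rw [List.take_add_one, List.map_append, value_append]
    refine (dist_mul_right_value_le _ _).trans ?_
    cases V[t]? <;> simp
  have letter : ∀ (g : G) (z : Z), dist Z g (g * z) ≤ 1 := fun g z => by
    simpa using dist_mul_right_value_le g [z]
  induction W generalizing a b with
  | nil =>
    obtain ⟨rfl, rfl⟩ := add_eq_zero.1 hab.symm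
    exact ⟨[], rfl, by simp⟩
  | cons z W ih =>
    by_cases h : (z : G) ∈ N
    · have ho : outerPart N (z :: W) = outerPart N W := by simp [outerPart, h]
      rw [hZ.innerPart_cons_of_mem h] at hab
      rw [ho]
      rcases Multiset.mem_add.1 (hab ▸ Multiset.mem_cons_self _ _ :
        (⟨z, h⟩ : InnerLetter N Z) ∈ a + b) with hz | hz
      · obtain ⟨a, rfl⟩ := Multiset.exists_cons_of_mem hz
        rw [Multiset.cons_add, Multiset.cons_inj_right] at hab
        obtain ⟨V, hV, hd⟩ := ih a b hab
        refine ⟨V, hV, fun t => ?_⟩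
        cases t with
        | zero => simp
        | succ t =>
          have h1 := hd t
          rw [← dist_mul_left (z : G)] at h1
          have h2 : dist Z (z * value ((V.take t).map Subtype.val))
              (value ((V.take t).map Subtype.val)) ≤ 1 := by
            rw [value_map_val, mul_comm_of_mem h (innerValue_mem _), hZ.dist_comm]
            exact letter _ _
          have h3 := step V t
          have t1 := hZ.dist_triangle (z * value (W.take t))
            (z * value ((V.take t).map Subtype.val)) (value ((V.take t).map Subtype.val))
          have t2 := hZ.dist_triangle (z * value (W.take t))
            (value ((V.take t).map Subtype.val)) (value ((V.take (t + 1)).map Subtype.val))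
          rw [List.take_succ_cons, value_cons, Multiset.card_cons]
          omega
      · obtain ⟨b, rfl⟩ := Multiset.exists_cons_of_mem hz
        rw [Multiset.add_cons, Multiset.cons_inj_right] at hab
        obtain ⟨V, rfl, hd⟩ := ih a b hab
        refine ⟨⟨z, h⟩ :: V, rfl, fun t => ?_⟩
        cases t with
        | zero => simp
        | succ t => simpa [dist_mul_left] using hd t
    · have ho : outerPart N (z :: W) = z :: outerPart N W := by simp [outerPart, h]
      rw [hZ.innerPart_cons_of_notMem h] at hab
      obtain ⟨V, hV, hd⟩ := ih (a.map (hZ.conj (z : G)⁻¹)) (b.map (hZ.conj (z : G)⁻¹)) (by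
        rw [← Multiset.map_add, ← hab, hZ.map_conj_map_conj]
        simp [hZ.conj_one])
      refine ⟨V.map (hZ.conj z), ?_, fun t => ?_⟩
      · rw [← Multiset.map_coe, hV, hZ.map_conj_map_conj]
        simp [hZ.conj_one]
      · cases t with
        | zero => simp
        | succ t =>
          have h1 := hd t
          rw [← dist_mul_left (z : G), Multiset.card_map] at h1
          have h2 := step V t
          rw [← dist_mul_left (z : G)] at h2
          have h3 : dist Z (z * value ((V.take (t + 1)).map Subtype.val))
              (value (((V.map (hZ.conj z)).take (t + 1)).map Subtype.val)) ≤ 1 := by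
            rw [value_map_val, value_map_val, ← List.map_take, ← Multiset.map_coe,
              hZ.innerValue_map_conj]
            exact letter _ ⟨_, hZ.inv_mem _ z.2⟩
          have t1 := hZ.dist_triangle (z * value (W.take t))
            (z * value ((V.take t).map Subtype.val)) (z * value ((V.take (t + 1)).map Subtype.val))
          have t2 := hZ.dist_triangle (z * value (W.take t))
            (z * value ((V.take (t + 1)).map Subtype.val))
            (value (((V.map (hZ.conj z)).take (t + 1)).map Subtype.val))
          rw [List.take_succ_cons, value_cons, ho, List.length_cons]
          omega

theorem exists_shorter_word (hZ : IsAdaptedGenSet N Z m) :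
    ∃ K, ∀ W : List Z, (outerPart N W).length ≤ m → wordLength Z (value W) < W.length →
      ∃ Q : List Z, value Q = value W ∧ Q.length < W.length ∧ W.length ≤ Q.length + K ∧
        ∀ t, dist Z (value (W.take t)) (value (Q.take t)) ≤ K := by
  obtain ⟨C, hC⟩ := hZ.exists_bound_of_shorter m
  -- The shadow contributes `2 * (C + m)`, and the geodesic `R` replacing the bounded part and the
  -- outer letters contributes at most `C + m`.
  refine ⟨3 * (C + m), fun W hWm hW => ?_⟩
  rw [hZ.value_eq, hZ.length_eq] at hW
  obtain ⟨a, ha, haC, hlt⟩ := hC _ hWm _ hW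
  obtain ⟨b, hb⟩ := Multiset.le_iff_exists_add.1 ha
  obtain ⟨V, rfl, hV⟩ := hZ.exists_shadow W a b hb
  obtain ⟨R, hR, hRl⟩ := hZ.exists_word (innerValue a * value (outerPart N W))
  have hWl := hZ.length_eq W
  rw [hb, Multiset.card_add, Multiset.coe_card] at hWl
  refine ⟨V.map Subtype.val ++ R, ?_, ?_, ?_, fun t => ?_⟩
  · rw [value_append, hR, value_map_val, ← mul_assoc, ← innerValue_add, add_comm, ← hb,
      ← hZ.value_eq]
  · rw [List.length_append, List.length_map]; omega
  · rw [List.length_append, List.length_map]; omega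
  · have h1 := hV t
    have h2 : dist Z (value ((V.take t).map Subtype.val))
        (value ((V.map Subtype.val ++ R).take t)) ≤ R.length := by
      rw [List.take_append, value_append, List.map_take]
      exact (dist_mul_right_value_le _ _).trans (by simp)
    have t1 := hZ.dist_triangle (value (W.take t)) (value ((V.take t).map Subtype.val))
      (value ((V.map Subtype.val ++ R).take t))
    omega

omit [IsMulCommutative N] hN in
theorem exists_prefix_outerPart (W : List Z) (n : ℕ) :
    ∃ P R, W = P ++ R ∧ (outerPart N P).length = min n (outerPart N W).length := by
  induction W generalizing n with
  | nil => exact ⟨[], [], by simp, by simp [outerPart]⟩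
  | cons z W ih =>
    by_cases h : (z : G) ∈ N
    · obtain ⟨P, R, rfl, hP⟩ := ih n
      exact ⟨z :: P, R, rfl, by simpa [outerPart, h] using hP⟩
    · cases n with
      | zero => exact ⟨[], z :: W, rfl, by simp [outerPart]⟩
      | succ n =>
        obtain ⟨P, R, rfl, hP⟩ := ih n
        exact ⟨z :: P, R, rfl, by simpa [outerPart, h] using hP⟩

theorem fftp (hZ : IsAdaptedGenSet N Z m) : FFTP Z := by
  obtain ⟨K, hK⟩ := hZ.exists_shorter_word
  refine ⟨K, fun p hp => ?_⟩
  rw [Path.isGeodesic_iff, isGeodesicWord_iff, not_le] at hp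
  obtain ⟨g, W⟩ := p
  -- A prefix with exactly `m` outer letters is already non-geodesic, so only words with at most `m`
  -- outer letters need shortening.
  obtain ⟨P, R, rfl, hPm, hPlt⟩ : ∃ P R, W = P ++ R ∧ (outerPart N P).length ≤ m ∧
      wordLength Z (value P) < P.length := by
    rcases le_total (outerPart N W).length m with h | h
    · exact ⟨W, [], by simp, h, hp⟩
    · obtain ⟨P, R, rfl, hP⟩ := exists_prefix_outerPart (N := N) W m
      exact ⟨P, R, rfl, by omega, hZ.wordLength_lt_of_outerPart (by omega)⟩
  obtain ⟨Q, hQ, hlt, hle, hd⟩ := hK P hPm hPlt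
  refine ⟨⟨g, Q ++ R⟩, by simpa [Path.length] using hlt, rfl, by simp [Path.terminus, hQ],
    id, id, monotone_id, monotone_id, ?_⟩
  refine (and_self_iff (a := ∀ t, _)).2 fun t => ?_
  simp only [Path.vertex, id, dist_mul_left]
  rcases le_total t Q.length with h | h
  · rw [List.take_append_of_le_length (by omega), List.take_append_of_le_length h]
    exact hd t
  -- Past the end of `Q` the new path runs along the old one, ahead by a bounded time.
  · have e : value ((Q ++ R).take t) = value ((P ++ R).take (t + (P.length - Q.length))) := by
      rw [List.take_append, List.take_append, List.take_of_length_le h,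
        List.take_of_length_le (show P.length ≤ t + (P.length - Q.length) by omega),
        value_append, value_append, hQ,
        show t + (P.length - Q.length) - P.length = t - Q.length by omega]
    rw [e, List.take_add, value_append]
    exact (dist_mul_right_value_le _ _).trans (by simp; omega)

/-! ### The neighboring shorter conjugate property -/

theorem nsc (hZ : IsAdaptedGenSet N Z m) : NSC Z := by
  have hfin := hZ.finite.to_subtype
  let shorter (p : List Z × List Z) (a c : Multiset (InnerLetter N Z)) : Prop :=
    wordLength Z (innerValue c * value p.1 * (innerValue a * value p.2) *
      (innerValue c * value p.1)⁻¹) < a.card + p.2.length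
  obtain ⟨C, hC⟩ := exists_uniform_bound
    ((List.finite_length_le Z m).prod (List.finite_length_le Z m)) (P := fun p C =>
      ∀ a c, shorter p a c → ∃ c', c'.card ≤ C ∧ shorter p a c')
    (fun p k l hkl h a c hac => by
      obtain ⟨c', h1, h2⟩ := h a c hac
      exact ⟨c', h1.trans hkl, h2⟩)
    (fun p _ => by
      obtain ⟨C, hC⟩ := exists_small_le_of_wellQuasiOrdered
        {q : Multiset (InnerLetter N Z) × Multiset (InnerLetter N Z) | shorter p q.1 q.2}
        (fun q => q.2.card)
      refine ⟨C, fun a c hac => ?_⟩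
      -- The set need not be upward closed in `c`, so `c'` is kept and only `a'` is enlarged back to
      -- `a`. The restored letters `e` contribute a conjugate of length at most `e.card`.
      obtain ⟨⟨a', c'⟩, h1, ⟨h2, -⟩, h3⟩ := hC (a, c) hac
      obtain ⟨e, rfl⟩ := Multiset.le_iff_exists_add.1 h2
      refine ⟨c', h3, ?_⟩
      have e1 : innerValue c' * value p.1 * (innerValue (a' + e) * value p.2) *
          (innerValue c' * value p.1)⁻¹ = innerValue (e.map (hZ.conj (value p.1))) *
          (innerValue c' * value p.1 * (innerValue a' * value p.2) *
          (innerValue c' * value p.1)⁻¹) := by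
        have e2 := mul_comm_of_mem (innerValue_mem c')
          (innerValue_mem (e.map (hZ.conj (value p.1))))
        calc _ = innerValue c' * innerValue (e.map (hZ.conj (value p.1))) * value p.1 *
              (innerValue a' * value p.2) * (innerValue c' * value p.1)⁻¹ := by
              rw [hZ.innerValue_map_conj, add_comm a', innerValue_add]; group
          _ = _ := by rw [e2]; group
      have h4 := wordLength_innerValue_le (e.map (hZ.conj (value p.1)))
      rw [Multiset.card_map] at h4
      have h5 := hZ.wordLength_mul_le (innerValue (e.map (hZ.conj (value p.1))))
        (innerValue c' * value p.1 * (innerValue a' * value p.2) *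
          (innerValue c' * value p.1)⁻¹)
      rw [← e1] at h5
      simp only [Set.mem_ofPred_eq, shorter, Multiset.card_add] at h1 ⊢
      omega)
  refine ⟨C + m, fun U hU _ => ?_⟩
  rintro ⟨h, hconj, hlt⟩
  obtain ⟨k, rfl⟩ := isConj_iff.1 hconj
  obtain ⟨V, rfl, hV⟩ := hZ.exists_word k
  have hVm := hZ.length_outerPart_lt (isGeodesicWord_iff.2 hV.le)
  have hUm := hZ.length_outerPart_lt (hU U (List.IsRotated.refl U))
  obtain ⟨c, hc, hs⟩ := hC (outerPart N V, outerPart N U) ⟨hVm.le, hUm.le⟩ (hZ.innerPart U)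
    (hZ.innerPart V) (by
      simp only [shorter]
      rwa [← hZ.value_eq, ← hZ.value_eq, ← hZ.length_eq])
  refine ⟨U, List.IsRotated.refl U, innerValue c * value (outerPart N V), ?_, ?_⟩
  · have h1 := hZ.wordLength_mul_le (innerValue c) (value (outerPart N V))
    have h2 := wordLength_innerValue_le c
    have h3 := wordLength_value_le (outerPart N V)
    omega
  · simp only [shorter] at hs
    rwa [← hZ.value_eq, ← hZ.length_eq] at hs

end IsAdaptedGenSet

end CayleyGeom

namespace CayleyGeom

/-! ### Regular languages -/

/-- A language is regular if it belongs to a finite family of languages such that the derivatives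
of the members of the family by letters are unions of members of the family. -/
theorem isRegular_of_finite_derivatives {A : Type*} {𝓕 : Set (Language A)} (hfin : 𝓕.Finite)
    (hd : ∀ K ∈ 𝓕, ∀ a V, a :: V ∈ K → ∃ K' ∈ 𝓕, V ∈ K' ∧ ∀ V' ∈ K', a :: V' ∈ K)
    {L : Language A} (hL : L ∈ 𝓕) : L.IsRegular := by
  have key : ∀ W V : List A, ∀ L ∈ 𝓕, W ++ V ∈ L →
      ∃ K ∈ 𝓕, V ∈ K ∧ ∀ V' ∈ K, W ++ V' ∈ L := by
    intro W V
    induction W with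
    | nil => exact fun L hL hV => ⟨L, hL, hV, fun _ h => h⟩
    | cons a W ih =>
      intro L hL hV
      obtain ⟨K, hK, h1, h2⟩ := hd L hL a _ hV
      obtain ⟨K', hK', h3, h4⟩ := ih K hK h1
      exact ⟨K', hK', h3, fun V' hV' => h2 _ (h4 V' hV')⟩
  refine Language.IsRegular.of_finite_range_leftQuotient ((hfin.powerset.image
    fun 𝓢 => ({V | ∃ K ∈ 𝓢, V ∈ K} : Language A)).subset ?_)
  rintro _ ⟨W, rfl⟩
  refine ⟨{K ∈ 𝓕 | ∀ V ∈ K, W ++ V ∈ L}, fun K hK => hK.1, ?_⟩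
  ext V
  constructor
  · rintro ⟨K, hK, hV⟩
    exact hK.2 V hV
  · intro hV
    obtain ⟨K, hK, h1, h2⟩ := key W V L hL hV
    exact ⟨K, ⟨hK, h2⟩, h1⟩

/-- The words that consist of the blocks `σ x`, for `x` in a list sorted by `R` with entries
in `q`, followed by a word of length at most `C`. -/
def blockLanguage {A β : Type*} (σ : β → List A) (R : β → β → Prop) (C : ℕ) (q : Set β) :
    Language A :=
  {W | ∃ (f : List β) (ρ : List A), (∀ x ∈ f, x ∈ q) ∧ f.Pairwise R ∧ ρ.length ≤ C ∧
    W = f.flatMap σ ++ ρ}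

theorem isRegular_blockLanguage {A β : Type*} [Finite β] (σ : β → List A) (R : β → β → Prop)
    (C : ℕ) (q : Set β) (hσ : ∀ x ∈ q, σ x ≠ []) : (blockLanguage σ R C q).IsRegular := by
  -- States of a nondeterministic automaton: `rest` records the blocks still allowed and the unread
  -- suffix of the current block, `short` the number of letters left in the tail.
  let rest (p : Set β × List A) : Language A := {W | ∃ V ∈ blockLanguage σ R C p.1, W = p.2 ++ V}
  let short (n : ℕ) : Language A := {W | W.length ≤ n}
  let suffixes : Set (List A) := {r | r = [] ∨ ∃ x, r <:+ σ x}
  have hsuf : suffixes.Finite := by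
    refine ((Set.finite_singleton []).union
      (Set.finite_iUnion fun x : β => List.finite_toSet (σ x).tails)).subset ?_
    rintro r (rfl | ⟨x, hx⟩)
    · exact Or.inl rfl
    · exact Or.inr (Set.mem_iUnion.2 ⟨x, by simpa using hx⟩)
  refine isRegular_of_finite_derivatives
    (𝓕 := rest '' ({s | s ⊆ q} ×ˢ suffixes) ∪ short '' Set.Iic C)
    ((((Set.toFinite _).prod hsuf).image _).union ((Set.finite_Iic C).image _)) ?_
    (Or.inl ⟨(q, []), ⟨Set.Subset.refl q, Or.inl rfl⟩, ?_⟩)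
  · rintro K (⟨⟨s, r⟩, ⟨hs, hr⟩, rfl⟩ | ⟨n, hn, rfl⟩) a V hV
    · cases r with
      | cons b r =>
        obtain ⟨V', hV', he⟩ := hV
        obtain ⟨rfl, rfl⟩ := List.cons.inj he
        refine ⟨_, Or.inl ⟨(s, r), ⟨hs, Or.inr ?_⟩, rfl⟩, ⟨V', hV', rfl⟩, ?_⟩
        · obtain ⟨x, hx⟩ := hr.resolve_left (by simp)
          exact ⟨x, (List.suffix_cons _ _).trans hx⟩
        · rintro _ ⟨V', hV', rfl⟩
          exact ⟨V', hV', rfl⟩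
      | nil =>
        obtain ⟨_, ⟨f, ρ, h1, h2, h3, rfl⟩, he⟩ := hV
        cases f with
        | nil =>
          simp only [List.flatMap_nil, List.nil_append] at he
          subst he
          rw [List.length_cons] at h3
          refine ⟨_, Or.inr ⟨C - 1, by simp, rfl⟩, (by omega : V.length ≤ C - 1), fun V' hV' => ?_⟩
          have hV'' : V'.length ≤ C - 1 := hV'
          exact ⟨_, ⟨[], a :: V', by simp, by simp, by rw [List.length_cons]; omega, rfl⟩, rfl⟩
        | cons x f =>
          obtain ⟨b, r, hx⟩ := List.exists_cons_of_ne_nil (hσ x (hs (h1 x (by simp))))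
          rw [List.pairwise_cons] at h2
          rw [List.nil_append, List.flatMap_cons, hx] at he
          obtain ⟨rfl, rfl⟩ := List.cons.inj he
          refine ⟨_, Or.inl ⟨(s ∩ {y | R x y}, r), ⟨Set.inter_subset_left.trans hs,
            Or.inr ⟨x, hx ▸ List.suffix_cons _ _⟩⟩, rfl⟩,
            ⟨_, ⟨f, ρ, fun y hy => ⟨h1 y (by simp [hy]), h2.1 y hy⟩, h2.2, h3, rfl⟩, by simp⟩, ?_⟩
          rintro _ ⟨_, ⟨g, τ, g1, g2, g3, rfl⟩, rfl⟩
          refine ⟨_, ⟨x :: g, τ, ?_, List.pairwise_cons.2 ⟨fun y hy => (g1 y hy).2, g2⟩, g3, rfl⟩,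
            by simp [hx]⟩
          intro y hy
          rcases List.mem_cons.1 hy with rfl | hy
          exacts [h1 _ (by simp), (g1 y hy).1]
    · have hV' : (a :: V).length ≤ n := hV
      rw [List.length_cons] at hV'
      refine ⟨_, Or.inr ⟨n - 1, (Nat.sub_le _ _).trans hn, rfl⟩, (by omega : V.length ≤ n - 1),
        fun U hU => ?_⟩
      have hU' : U.length ≤ n - 1 := hU
      change (a :: U).length ≤ n
      rw [List.length_cons]
      omega
  · ext W
    exact ⟨fun ⟨V, hV, h⟩ => h ▸ hV, fun h => ⟨W, h, rfl⟩⟩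

theorem exists_take_flatMap_append {A β : Type*} (σ : β → List A) {D : ℕ}
    (hσ : ∀ x, (σ x).length ≤ D) (f : List β) {ρ : List A} (hρ : ρ.length ≤ D) (t : ℕ) :
    ∃ j r, (f.flatMap σ ++ ρ).take t = (f.take j).flatMap σ ++ r ∧ r.length ≤ D := by
  induction f generalizing t with
  | nil => exact ⟨0, ρ.take t, by simp, by simp [hρ]⟩
  | cons x f ih =>
    rcases le_total t (σ x).length with h | h
    · refine ⟨0, (σ x).take t, ?_, (List.length_take_le' _ _).trans (hσ x)⟩
      rw [List.flatMap_cons, List.append_assoc, List.take_append_of_le_length h]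
      simp
    · obtain ⟨j, r, h1, h2⟩ := ih (t - (σ x).length)
      refine ⟨j + 1, r, ?_, h2⟩
      rw [List.flatMap_cons, List.append_assoc, List.take_append, List.take_of_length_le h, h1]
      simp

/-! ### Symmetries of faces -/

theorem IsFace.map {α M : Type*} [AddCancelCommMonoid M] {π : Multiset α →+ M} {F : Finset α}
    (hF : IsFace π F) (e : α ≃ α)
    (he : ∀ a b : Multiset α, π a = π b → π (a.map e.symm) = π (b.map e.symm)) :
    IsFace π (F.map e.toEmbedding) := by
  have hmem : ∀ a : Multiset α, (∀ s ∈ a, s ∈ F.map e.toEmbedding) ↔ ∀ s ∈ a.map e.symm, s ∈ F := by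
    simp
  refine ⟨hF.nonempty.map, fun a ha b hb => ?_, fun a b ha hab hc => ?_⟩
  · simpa using hF.tight _ ((hmem a).1 ha) (b.map e.symm) (he _ _ hb)
  · exact (hmem b).2 (hF.closed _ _ ((hmem a).1 ha) (he _ _ hab) (by simpa using hc))

theorem faceSum_map {α : Type*} (e : α ≃ α) (f : List (Finset α)) :
    faceSum (f.map (Finset.map e.toEmbedding) : List (Finset α)) =
      (faceSum (f : Multiset (Finset α))).map e := by
  induction f with
  | nil => simp
  | cons F f ih =>
    rw [List.map_cons, ← Multiset.cons_coe, faceSum_cons, ih, ← Multiset.cons_coe, faceSum_cons,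
      Multiset.map_add, Finset.map_val]
    rfl

/-! ### The biautomatic structure of an adapted generating set -/

namespace IsAdaptedGenSet

open scoped IsMulCommutative

variable {G : Type*} [Group G] {N : Subgroup G} {Z : Set G} [IsMulCommutative N] [hN : N.Normal]
  {m : ℕ}

/-- By `exists_bound_of_shorter`, non-geodesicity is detected by at most `C` inner letters. Hence
the left quotient by `W` depends only on the outer part and on the inner multiplicities truncated at
`C`, with a single value `none` for words with too many outer letters. -/
theorem isRegular_geodesic (hZ : IsAdaptedGenSet N Z m) :
    Language.IsRegular ({W | IsGeodesicWord W} : Language Z) := by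
  classical
  have := hZ.finite.to_subtype
  have := hZ.finite_innerLetter
  set L : Language Z := {W | IsGeodesicWord W} with hL
  have memL : ∀ W, W ∈ L ↔ IsGeodesicWord W := fun W => Iff.rfl
  obtain ⟨C, hC⟩ := hZ.exists_bound_of_shorter m
  let key (W : List Z) : Option (List Z × (InnerLetter N Z → ℕ)) :=
    if (outerPart N W).length < m then
      some (outerPart N W, fun s => min ((hZ.innerPart W).count s) C) else none
  have hkey : (Set.range key).Finite := by
    refine (((List.finite_length_le Z m).prod
      (Set.Finite.pi fun _ : InnerLetter N Z => Set.finite_Iic C)).image some |>.insert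
        none).subset ?_
    rintro _ ⟨W, rfl⟩
    by_cases h : (outerPart N W).length < m
    · exact Or.inr ⟨(outerPart N W, fun s => min ((hZ.innerPart W).count s) C),
        ⟨h.le, fun s _ => Set.mem_Iic.2 (min_le_right _ _)⟩, by simp [key, h]⟩
    · exact Or.inl (by simp [key, h])
  have hgeo : ∀ W W' V, key W = key W' → W ++ V ∈ L → W' ++ V ∈ L := by
    intro W W' V hk h
    rw [memL] at h ⊢
    have hlt := hZ.length_outerPart_lt h
    rw [outerPart_append, List.length_append] at hlt
    by_cases h' : (outerPart N W').length < m
    swap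
    · simp [key, h', show (outerPart N W).length < m by omega] at hk
    simp only [key, h', show (outerPart N W).length < m by omega, if_true, Option.some.injEq,
      Prod.mk.injEq] at hk
    obtain ⟨hk1, hk2⟩ := hk
    rw [hZ.isGeodesicWord_iff_not_lt] at h ⊢
    rw [outerPart_append, hZ.innerPart_append] at h ⊢
    rw [← hk1]
    intro hs
    obtain ⟨b, hb, hbC, hbs⟩ := hC _ (by rw [List.length_append]; omega) _ hs
    refine h (hZ.wordLength_innerValue_add_mul_lt (Multiset.le_iff_count.2 fun s => ?_) hbs)
    have h1 := Multiset.le_iff_count.1 hb s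
    have h2 := congrFun hk2 s
    have h3 := Multiset.count_le_card s b
    simp only [Multiset.count_add] at h1 h2 ⊢
    omega
  have hfac : Function.FactorsThrough L.leftQuotient key := fun W W' h => by
    ext V
    exact ⟨hgeo W W' V h, hgeo W' W V h.symm⟩
  obtain ⟨e, he⟩ := (Function.factorsThrough_iff _).1 hfac
  refine Language.IsRegular.of_finite_range_leftQuotient ?_
  rw [he, Set.range_comp]
  exact hkey.image e

/-- Conjugation as a permutation of the letters in `N`. -/
def conjEquiv (hZ : IsAdaptedGenSet N Z m) (g : G) : InnerLetter N Z ≃ InnerLetter N Z where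
  toFun := hZ.conj g
  invFun := hZ.conj g⁻¹
  left_inv z := by rw [hZ.conj_conj, inv_mul_cancel, hZ.conj_one]
  right_inv z := by rw [hZ.conj_conj, mul_inv_cancel, hZ.conj_one]

theorem isFlag_map_conj (hZ : IsAdaptedGenSet N Z m) (g : G) {f : List (Finset (InnerLetter N Z))}
    (hf : IsFlag (innerHom N Z) f) :
    IsFlag (innerHom N Z) (f.map (Finset.map (hZ.conjEquiv g).toEmbedding)) := by
  refine ⟨fun F hF => ?_, List.pairwise_map.2 (hf.pairwise.imp fun h => Finset.map_subset_map.2 h)⟩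
  obtain ⟨H, hH, rfl⟩ := List.mem_map.1 hF
  refine (hf.face H hH).map _ fun a b hab => ?_
  rw [innerHom_eq_iff] at hab ⊢
  change innerValue (a.map (hZ.conj g⁻¹)) = innerValue (b.map (hZ.conj g⁻¹))
  rw [hZ.innerValue_map_conj, hZ.innerValue_map_conj, hab]

theorem innerValue_faceSum_map_conj (hZ : IsAdaptedGenSet N Z m) (g : G)
    (f : List (Finset (InnerLetter N Z))) :
    innerValue (faceSum (f.map (Finset.map (hZ.conjEquiv g).toEmbedding) :
        Multiset (Finset (InnerLetter N Z)))) =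
      g * innerValue (faceSum (f : Multiset (Finset (InnerLetter N Z)))) * g⁻¹ := by
  rw [faceSum_map, ← hZ.innerValue_map_conj]
  rfl

/-- The word that spells a set of letters in `N`, in an arbitrary order. -/
noncomputable def _root_.CayleyGeom.faceWord (F : Finset (InnerLetter N Z)) : List Z :=
  F.toList.map Subtype.val

omit hN in
theorem _root_.CayleyGeom.value_flatMap_faceWord (f : List (Finset (InnerLetter N Z))) :
    value (f.flatMap faceWord) =
      innerValue (faceSum (f : Multiset (Finset (InnerLetter N Z)))) := by
  induction f with
  | nil => simp
  | cons F f ih =>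
    rw [List.flatMap_cons, value_append, ih, ← Multiset.cons_coe, faceSum_cons, innerValue_add,
      faceWord, value_map_val, Finset.coe_toList]

omit [IsMulCommutative N] hN in
theorem _root_.CayleyGeom.length_flatMap_faceWord (f : List (Finset (InnerLetter N Z))) :
    (f.flatMap faceWord).length = (faceSum (f : Multiset (Finset (InnerLetter N Z)))).card := by
  induction f with
  | nil => simp
  | cons F f ih =>
    rw [List.flatMap_cons, List.length_append, ih, ← Multiset.cons_coe, faceSum_cons,
      Multiset.card_add, faceWord, List.length_map, Finset.length_toList, Finset.card_val]

/-- The language of all words that spell a flag of faces, followed by at most `C` letters. -/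
noncomputable def _root_.CayleyGeom.flagLanguage (N : Subgroup G) [IsMulCommutative N] (Z : Set G)
    (C : ℕ) : Language Z :=
  blockLanguage faceWord (fun F H => H ⊆ F) C {F | IsFace (innerHom N Z) F}

omit hN in
theorem _root_.CayleyGeom.mem_flagLanguage {C : ℕ} {W : List Z} :
    W ∈ flagLanguage N Z C ↔ ∃ f ρ, IsFlag (innerHom N Z) f ∧ ρ.length ≤ C ∧
      W = f.flatMap faceWord ++ ρ :=
  ⟨fun ⟨f, ρ, h1, h2, h3, h4⟩ => ⟨f, ρ, ⟨h1, h2⟩, h3, h4⟩,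
    fun ⟨f, ρ, h1, h3, h4⟩ => ⟨f, ρ, h1.face, h1.pairwise, h3, h4⟩⟩

theorem isTight_innerPart (hZ : IsAdaptedGenSet N Z m) {W : List Z} (hW : IsGeodesicWord W) :
    IsTight (innerHom N Z) (hZ.innerPart W) := by
  intro b hb
  rw [innerHom_eq_iff] at hb
  rw [isGeodesicWord_iff, hZ.value_eq, ← hb, hZ.length_eq] at hW
  have h1 := hZ.wordLength_mul_le (innerValue b) (value (outerPart N W))
  have h2 := wordLength_innerValue_le b
  have h3 := wordLength_value_le (outerPart N W)
  omega

/-- The inner part of a geodesic is tight; trading it for a flag and a bounded remainder, followed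
by the fewer than `m` outer letters, changes neither value nor length. -/
theorem exists_geodesic_mem_flagLanguage (hZ : IsAdaptedGenSet N Z m) :
    ∃ C, ∀ g : G, ∃ W ∈ flagLanguage N Z C, IsGeodesicWord W ∧ value W = g := by
  have := hZ.finite_innerLetter
  obtain ⟨C, hC⟩ := exists_flag_of_isTight (innerHom N Z)
  refine ⟨C + m, fun g => ?_⟩
  obtain ⟨W, rfl, hW⟩ := hZ.exists_word g
  have hgeo : IsGeodesicWord W := isGeodesicWord_iff.2 hW.le
  obtain ⟨f, r, hf, hr, hπ, hc⟩ := hC _ (hZ.isTight_innerPart hgeo)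
  rw [← map_add, innerHom_eq_iff, innerValue_add] at hπ
  have hm := hZ.length_outerPart_lt hgeo
  have hval : value (f.flatMap faceWord ++ (r.toList.map Subtype.val ++ outerPart N W)) =
      value W := by
    rw [value_append, value_append, value_flatMap_faceWord, value_map_val, Multiset.coe_toList,
      hZ.value_eq W, hπ, mul_assoc]
  have hlen := hZ.length_eq W
  refine ⟨_, mem_flagLanguage.2 ⟨f, r.toList.map Subtype.val ++ outerPart N W, hf, ?_, rfl⟩, ?_,
    hval⟩
  · simp only [List.length_append, List.length_map, Multiset.length_toList]
    omega
  · rw [isGeodesicWord_iff, hval, ← hW, List.length_append, length_flatMap_faceWord]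
    simp only [List.length_append, List.length_map, Multiset.length_toList]
    omega

theorem wordLength_le_one {x : G} (hx : x ∈ Z ∪ {1}) : wordLength Z x ≤ 1 := by
  rcases hx with hx | rfl
  · simpa using wordLength_value_le (X := Z) [⟨x, hx⟩]
  · simp

theorem exists_fellowTravel (hZ : IsAdaptedGenSet N Z m) {C : ℕ}
    (hC : Nat.card (InnerLetter N Z) ≤ C) :
    ∃ M : ℕ, ∀ W ∈ flagLanguage N Z C, ∀ U ∈ flagLanguage N Z C, IsGeodesicWord W →
      IsGeodesicWord U → ∀ x ∈ Z ∪ {1}, ∀ y ∈ Z ∪ {1}, value U = x * value W * y →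
        SyncFellowTravel M (Path.mk x W) (Path.mk 1 U) := by
  have := hZ.finite_innerLetter
  have := Fintype.ofFinite (InnerLetter N Z)
  have hσ : ∀ F : Finset (InnerLetter N Z), (faceWord F).length ≤ C := fun F => by
    rw [faceWord, List.length_map, Finset.length_toList]
    exact (F.card_le_univ.trans (Nat.card_eq_fintype_card).ge).trans hC
  -- The two flags, one of them conjugated by `x`, differ by `x ρ y ρ'⁻¹`, where the tails have
  -- length at most `C` and `x`, `y` at most 1. Only finitely many differences occur, so `K` can be
  -- chosen uniformly.
  have hball : {w : Additive N | wordLength Z (w.toMul : G) ≤ 2 * C + 2}.Finite :=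
    (hZ.finite_ball (2 * C + 2)).preimage (fun a _ b _ h => by simpa using h)
  obtain ⟨K, hK⟩ := exists_uniform_bound hball (P := FlagPrefixesWithin (innerHom N Z))
    (fun _ _ _ hkl h => h.mono hkl) (fun w _ => exists_flagPrefixesWithin _ w)
  refine ⟨2 * C + 1 + 2 * (K + (C + 2)), fun W hW U hU hWg hUg x hx y hy hval t => ?_⟩
  have hx1 := wordLength_le_one hx
  have hy1 := wordLength_le_one hy
  have hlen1 : U.length ≤ W.length + 2 := by
    have h1 := isGeodesicWord_iff.1 hUg
    have h2 := hZ.wordLength_mul_le (x * value W) y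
    have h3 := hZ.wordLength_mul_le x (value W)
    have h4 := wordLength_value_le W
    rw [hval] at h1
    omega
  have hlen2 : W.length ≤ U.length + 2 := by
    have h1 := isGeodesicWord_iff.1 hWg
    have h2 := hZ.wordLength_mul_le (x⁻¹ * value U) y⁻¹
    have h3 := hZ.wordLength_mul_le x⁻¹ (value U)
    have h4 := wordLength_value_le U
    rw [hZ.wordLength_inv] at h2 h3
    rw [show value W = x⁻¹ * value U * y⁻¹ by rw [hval]; group] at h1
    omega
  obtain ⟨f, ρ, hf, hρ, rfl⟩ := mem_flagLanguage.1 hW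
  obtain ⟨f', ρ', hf', hρ', rfl⟩ := mem_flagLanguage.1 hU
  obtain ⟨j, r, htW, hr⟩ := exists_take_flatMap_append faceWord hσ f hρ t
  obtain ⟨j', r', htU, hr'⟩ := exists_take_flatMap_append faceWord hσ f' hρ' t
  set f'' := f.map (Finset.map (hZ.conjEquiv x).toEmbedding) with hf''
  have hwN : x * value ρ * y * (value ρ')⁻¹ ∈ N := by
    have h1 : x * value ρ * y * (value ρ')⁻¹ =
        (innerValue (faceSum (f'' : Multiset (Finset (InnerLetter N Z)))))⁻¹ *
          innerValue (faceSum (f' : Multiset (Finset (InnerLetter N Z)))) := by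
      rw [hf'', hZ.innerValue_faceSum_map_conj, ← value_flatMap_faceWord f,
        ← value_flatMap_faceWord f']
      rw [value_append, value_append] at hval
      rw [eq_mul_inv_of_mul_eq hval]
      group
    rw [h1]
    exact N.mul_mem (N.inv_mem (innerValue_mem _)) (innerValue_mem _)
  have hw : innerHom N Z (faceSum (f' : Multiset (Finset (InnerLetter N Z)))) =
      innerHom N Z (faceSum (f'' : Multiset (Finset (InnerLetter N Z)))) +
        Additive.ofMul ⟨_, hwN⟩ := by
    apply Additive.toMul.injective
    apply Subtype.ext
    change innerValue (faceSum (f' : Multiset (Finset (InnerLetter N Z)))) =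
      innerValue (faceSum (f'' : Multiset (Finset (InnerLetter N Z)))) *
        (x * value ρ * y * (value ρ')⁻¹)
    rw [hf'', hZ.innerValue_faceSum_map_conj, ← value_flatMap_faceWord f,
      ← value_flatMap_faceWord f']
    rw [value_append, value_append] at hval
    rw [eq_mul_inv_of_mul_eq hval]
    group
  have hwl : wordLength Z (x * value ρ * y * (value ρ')⁻¹) ≤ 2 * C + 2 := by
    have h1 := hZ.wordLength_mul_le (x * value ρ * y) (value ρ')⁻¹
    have h2 := hZ.wordLength_mul_le (x * value ρ) y
    have h3 := hZ.wordLength_mul_le x (value ρ)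
    have h4 := wordLength_value_le ρ
    have h5 := wordLength_value_le ρ'
    rw [hZ.wordLength_inv] at h1
    omega
  have hcW := congrArg List.length htW
  have hcU := congrArg List.length htU
  simp only [List.length_take, List.length_append, length_flatMap_faceWord] at hcW hcU hlen1 hlen2
  have hcard : (faceSum (f''.take j : Multiset (Finset (InnerLetter N Z)))).card =
      (faceSum (f.take j : Multiset (Finset (InnerLetter N Z)))).card := by
    rw [hf'', ← List.map_take, faceSum_map, Multiset.card_map]
  -- At time `t` the flag prefixes differ in size by at most `C + 2`: the lengths of the words
  -- differ by at most 2, and each leftover fragment has at most `C` letters.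
  obtain ⟨p, q, hp, hq, hpq⟩ := hK (Additive.ofMul ⟨_, hwN⟩) hwl f' f'' hf'
    (hZ.isFlag_map_conj x hf) hw j' j (C + 2) (by omega) (by omega)
  have hpq' := congrArg innerValue hpq
  rw [innerValue_add, innerValue_add, hf'', ← List.map_take, hZ.innerValue_faceSum_map_conj] at hpq'
  have hdist : ((Path.mk x (f.flatMap faceWord ++ ρ)).vertex t)⁻¹ *
      (Path.mk 1 (f'.flatMap faceWord ++ ρ')).vertex t =
      (value r)⁻¹ * (x⁻¹ * (innerValue q * ((innerValue p)⁻¹ * value r'))) := by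
    simp only [Path.vertex, htW, htU, value_append, value_flatMap_faceWord]
    rw [eq_mul_inv_of_mul_eq hpq']
    group
  rw [dist, hdist]
  have h1 := hZ.wordLength_mul_le (value r)⁻¹
    (x⁻¹ * (innerValue q * ((innerValue p)⁻¹ * value r')))
  have h2 := hZ.wordLength_mul_le x⁻¹ (innerValue q * ((innerValue p)⁻¹ * value r'))
  have h3 := hZ.wordLength_mul_le (innerValue q) ((innerValue p)⁻¹ * value r')
  have h4 := hZ.wordLength_mul_le (innerValue p)⁻¹ (value r')
  rw [hZ.wordLength_inv] at h1 h2 h4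
  have h5 := wordLength_value_le r
  have h6 := wordLength_value_le r'
  have h7 := wordLength_innerValue_le p
  have h8 := wordLength_innerValue_le q
  omega

theorem exists_biautomatic (hZ : IsAdaptedGenSet N Z m) :
    ∃ L : Language Z, IsGeodesicPrefixClosedBiautomatic L := by
  have := hZ.finite_innerLetter
  have := Fintype.ofFinite (InnerLetter N Z)
  obtain ⟨C, hC⟩ := hZ.exists_geodesic_mem_flagLanguage
  -- The tail must have room for any face word, since a prefix may end inside one.
  set D := Nat.card (InnerLetter N Z) + C with hD
  have hmono : ∀ W ∈ flagLanguage N Z C, W ∈ flagLanguage N Z D := fun W hW => by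
    obtain ⟨f, ρ, hf, hρ, rfl⟩ := mem_flagLanguage.1 hW
    exact mem_flagLanguage.2 ⟨f, ρ, hf, by omega, rfl⟩
  have hreg : (flagLanguage N Z D).IsRegular :=
    isRegular_blockLanguage _ _ _ _ fun F hF h => by
      have h1 := (show IsFace (innerHom N Z) F from hF).nonempty.ne_empty
      simp [faceWord] at h
      exact h1 h
  have hmem : ∀ W : List Z, W ∈ flagLanguage N Z D ⊓ ({W | IsGeodesicWord W} : Language Z) ↔
      W ∈ flagLanguage N Z D ∧ IsGeodesicWord W := fun W => Iff.rfl
  refine ⟨flagLanguage N Z D ⊓ ({W | IsGeodesicWord W} : Language Z),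
    ⟨hreg.inf hZ.isRegular_geodesic, fun g => ?_, ?_⟩, fun W hW => ((hmem W).1 hW).2, ?_⟩
  · obtain ⟨W, h1, h2, h3⟩ := hC g
    exact ⟨W, (hmem W).2 ⟨hmono W h1, h2⟩, h3⟩
  · obtain ⟨M, hM⟩ := hZ.exists_fellowTravel (C := D) (Nat.le_add_right _ _)
    exact ⟨M, fun W hW U hU => hM W ((hmem W).1 hW).1 U ((hmem U).1 hU).1 ((hmem W).1 hW).2
      ((hmem U).1 hU).2⟩
  · intro W hW V hV
    obtain ⟨h1, h2⟩ := (hmem W).1 hW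
    refine (hmem V).2 ⟨?_, ?_⟩
    · obtain ⟨f, ρ, hf, hρ, rfl⟩ := mem_flagLanguage.1 h1
      obtain ⟨j, r, he, hr⟩ := exists_take_flatMap_append faceWord (fun F => by
        rw [faceWord, List.length_map, Finset.length_toList]
        have := F.card_le_univ
        rw [← Nat.card_eq_fintype_card] at this
        omega : ∀ F : Finset (InnerLetter N Z), (faceWord F).length ≤ D) f hρ V.length
      rw [← List.prefix_iff_eq_take.1 hV] at he
      exact mem_flagLanguage.2 ⟨f.take j, r, hf.sublist (List.take_sublist _ _), hr, he⟩
    · obtain ⟨R, rfl⟩ := hV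
      rw [isGeodesicWord_iff] at h2 ⊢
      have h3 := hZ.wordLength_mul_le (value V) (value R)
      have h4 := wordLength_value_le R
      rw [value_append, List.length_append] at h2
      omega

end IsAdaptedGenSet

end CayleyGeom

theorem proposition10p1 {G : Type*} [Group G] [Group.FG G]
    (hG : CayleyGeom.IsVirtuallyAbelian G)
    (Y : Set G) (hYfin : Y.Finite) (hYgen : Subgroup.closure Y = ⊤) :
    ∃ Z : Set G, Y ⊆ Z ∧ CayleyGeom.IsFiniteSymmGenSet Z ∧
      CayleyGeom.NSC Z ∧ CayleyGeom.FFTP Z ∧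
      ∃ L : Language Z, CayleyGeom.IsGeodesicPrefixClosedBiautomatic L := by
  obtain ⟨N, hfin, hcomm⟩ := hG
  -- Passing to the normal core makes the abelian subgroup normal and keeps its index finite.
  have : IsMulCommutative N.normalCore := ⟨⟨fun a b =>
    Subtype.ext (hcomm a (N.normalCore_le a.2) b (N.normalCore_le b.2))⟩⟩
  obtain ⟨Z, m, hYZ, hZ⟩ := CayleyGeom.exists_isAdaptedGenSet N.normalCore hYfin hYgen
  exact ⟨Z, hYZ, hZ.toIsFiniteSymmGenSet, hZ.nsc, hZ.fftp, hZ.exists_biautomatic⟩
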